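/- **Setting.** Let $n\ge 1$, let $M$, $X$ be smooth (finite-dimensional, Hausdorff, second countable) manifolds with $\dim X=n$, and let $\tau:M\to X$ be a surjective submersion; vectors in $\ker d\tau$ are called vertical. An $a$-form on $T_xM$ is *$r$-horizontal* if it vanishes whenever $a+1-r$ of its arguments are vertical, and *semi-basic* if it is $a$-horizontal. Let $S^a\subseteq\bigwedge^aT^*M$ ($1\le a\le n$) be vector subbundles with $S^{a}=\langle\iota_u\alpha: u\in TM,\ \alpha\in S^{a+1}\rangle$ for $1\le a<n$, let $K_1=\{v\in TM:\iota_vS^1=0\}$ and $K_n=\{U\in\bigwedge^nTM:\iota_US^n=0\}$, and let $\sharp_n:S^n\to TM/K_1$ be a vector bundle map with $\iota_{\sharp_n(\alpha)}\beta=-\iota_{\sharp_n(\beta)}\alpha$ for $\alpha,\beta\in S^n$. (These are the data of a regular graded Dirac structure of order $n$, whose other maps $\sharp_a$ are determined by $\sharp_n$; integrability is not needed below.) Assume the structure is fibered over $X$: for $1\le a\le n$, $S^a$ consists of $(a-1)$-horizontal forms and contains all semi-basic $a$-forms. A *Hamiltonian $(n-1)$-form* on an open $U\subseteq M$ is $\alpha\in\Omega^{n-1}(U)$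 with $d\alpha$ in $S^n$. For $\beta\in(S^1)^{\wedge(n+1)}$ let $\widetilde\sharp_1(\beta)\in\bigwedge^nT^*M\otimes(\bigwedge^nTM/K_n)=\mathrm{Hom}(S^n,\bigwedge^nT^*M)$ be given by $\iota_{\widetilde\sharp_1(\beta)}\alpha=\iota_{\sharp_n(\alpha)}\beta$, and let $\mathbb 1_n$ be the identity, $\iota_{\mathbb 1_n}\alpha=\alpha$. With $\iota_{\theta\otimes u}\alpha=\theta\wedge\iota_u\alpha$, put $$S^{n+1}[n]=\{\beta\in(S^1)^{\wedge(n+1)}:\ \exists\,L\in T^*M\otimes TM/K_1,\ \iota_L\alpha=\iota_{\widetilde\sharp_1(\beta)}\alpha\ \ \forall\alpha\in S^n\},$$ $$\Gamma=\{\beta\in S^{n+1}[n]:\ -\widetilde\sharp_1(\beta)+\mathbb 1_n\ \text{is semi-basic}\}.$$ A *Hamiltonian* is $\mathcal H\in\Omega^n(M)$ with $d\mathcal H$ in $S^{n+1}[n]$, such that $-\widetilde\sharp_1(d\mathcal H)+\mathbb 1_n$ is semi-basic and $\iota_{-\widetilde\sharp_1(d\mathcal H)+\mathbb 1_n}\omega=\omega$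 for all semi-basic $n$-forms $\omega$. The horizontal lift $h:\tau^*TX\to TM$ of an Ehresmann connection *solves the Hamilton–De Donder–Weyl equations of $\mathcal H$* if $h^*(d\alpha)=d\alpha-\iota_{\widetilde\sharp_1(d\mathcal H)}d\alpha$ for all Hamiltonian $(n-1)$-forms $\alpha$ on open subsets of $M$, where $(h^*\eta)(v_1,\dots,v_n)=\eta(h\,d\tau v_1,\dots,h\,d\tau v_n)$. A *horizontal lift modulo $K_1$* is a vector bundle map $g:\tau^*TX\to TM/K_1$ with $d\tau\circ g=\mathrm{id}$. A *vertical valued extension defined on $\Gamma$* is a smooth fibrewise affine map $\widetilde\sharp_n:\Gamma\to T^*M\otimes TM/K_1$ over $M$ with $\iota_{\widetilde\sharp_n(\beta)}\alpha=\iota_{\widetilde\sharp_1(\beta)}\alpha$ for all $\beta\in\Gamma$, $\alpha\in S^n$, whose values are tensors with values in $\ker d\tau/K_1$. **Theorem.** Suppose that $S^n$ is locally spanned by $d\alpha_1,\dots,d\alpha_r$ for Hamiltonian $(n-1)$-forms $\alpha_1,\dots,\alpha_r$, that $\Gamma$ is an affine subbundle of $\bigwedge^{n+1}T^*M$, and that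 every element of $\Gamma$ over a point $x$ is $d\mathcal H|_x$ for some Hamiltonian $\mathcal H$. Then there is a bijection between the vertical valued extensions $\widetilde\sharp_n$ defined on $\Gamma$ and the affine maps $$\gamma:\{\text{Hamiltonians}\}\to\{\text{horizontal lifts modulo }K_1\}$$ such that 1. if $d\mathcal H_1|_x=d\mathcal H_2|_x$, then $\gamma_{\mathcal H_1}|_x=\gamma_{\mathcal H_2}|_x$; 2. if $h$ is the horizontal lift of a connection and coincides with $\gamma_{\mathcal H}$ modulo $K_1$, then $h$ solves the Hamilton–De Donder–Weyl equations of $\mathcal H$. The bijection sends $\widetilde\sharp_n$ to the map $\gamma$ with $\gamma_{\mathcal H}(d\tau\,w)=w-\widetilde\sharp_n(d\mathcal H|_x)(w)\bmod K_1$ for $w\in T_xM$. -/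

import Mathlib

open Set
open scoped Manifold ContDiff

noncomputable section

namespace GradedDirac

/-! ## Differential forms on a manifold modelled on a finite-dimensional real vector space `E` -/

section Forms

variable (E : Type*) [NormedAddCommGroup E] [NormedSpace ℝ E]
  {M : Type*} [TopologicalSpace M] [ChartedSpace E M]

/-- `T_x M`. -/
abbrev Tan (x : M) : Type _ := TangentSpace 𝓘(ℝ, E) x

/-- Alternating `a`-forms on `T_x M`. -/
abbrev FormAt (x : M) (a : ℕ) : Type _ := Tan E x [⋀^Fin a]→L[ℝ] ℝ

variable (M) in
/-- Not necessarily smooth differential `a`-forms on `M`. A form on an open set `U` is represented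
by a form on `M` of which only the values on `U` are used. -/
abbrev DForm (a : ℕ) : Type _ := ∀ x : M, FormAt E x a

variable {E}

/-- The expression of `φ` in the chart around `x₀`: its pullback by the inverse of that chart. -/
def chartRep {a : ℕ} (φ : DForm E M a) (x₀ : M) (y : E) : E [⋀^Fin a]→L[ℝ] ℝ :=
  (φ ((extChartAt 𝓘(ℝ, E) x₀).symm y)).compContinuousLinearMap
    ((mfderiv 𝓘(ℝ, E) 𝓘(ℝ, E) (extChartAt 𝓘(ℝ, E) x₀).symm y).comp
      (NormedSpace.fromTangentSpace (𝕜 := ℝ) y).symm.toContinuousLinearMap)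

/-- `φ` is smooth on `U`: all its chart expressions are smooth. -/
def SmoothFormOn {a : ℕ} (φ : DForm E M a) (U : Set M) : Prop :=
  ∀ x₀ : M, ContDiffOn ℝ ∞ (chartRep φ x₀)
    ((extChartAt 𝓘(ℝ, E) x₀).target ∩ (extChartAt 𝓘(ℝ, E) x₀).symm ⁻¹' U)

/-- The exterior derivative `dφ`, computed at `x` in the chart around `x`. -/
def extD {a : ℕ} (φ : DForm E M a) : DForm E M (a + 1) := fun x =>
  (extDeriv (chartRep φ x) (extChartAt 𝓘(ℝ, E) x x)).compContinuousLinearMap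
    ((NormedSpace.fromTangentSpace (𝕜 := ℝ) (extChartAt 𝓘(ℝ, E) x x)).toContinuousLinearMap.comp
      (mfderiv 𝓘(ℝ, E) 𝓘(ℝ, E) (extChartAt 𝓘(ℝ, E) x) x))

/-- The vector field `Y` is smooth on `U`. -/
def SmoothFieldOn [IsManifold 𝓘(ℝ, E) ∞ M] (Y : ∀ x : M, Tan E x) (U : Set M) : Prop :=
  ContMDiffOn 𝓘(ℝ, E) 𝓘(ℝ, E).tangent ∞ (fun x => (⟨x, Y x⟩ : TangentBundle 𝓘(ℝ, E) M)) U

/-- The contraction `ι_u β`, i.e. `(v₁, …, v_a) ↦ β (u, v₁, …, v_a)`. -/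
def contr {x : M} {a : ℕ} (u : Tan E x) (β : FormAt E x (a + 1)) : FormAt E x a where
  toMultilinearMap := (β.toAlternatingMap.curryLeft u).toMultilinearMap
  cont := β.cont.comp (by fun_prop)
  map_eq_zero_of_eq' := (β.toAlternatingMap.curryLeft u).map_eq_zero_of_eq'

@[simp] theorem contr_apply {x : M} {a : ℕ} (u : Tan E x) (β : FormAt E x (a + 1))
    (v : Fin a → Tan E x) : contr u β v = β (Matrix.vecCons u v) := rfl

/-- The family of subspaces `S x ⊆ ⋀^a T_x^* M` is a smooth vector subbundle of `⋀^a M`. -/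
def IsSubbundle {a : ℕ} (S : ∀ x : M, Submodule ℝ (FormAt E x a)) : Prop :=
  ∀ x₀ : M, ∃ U : Set M, IsOpen U ∧ x₀ ∈ U ∧ ∃ (r : ℕ) (s : Fin r → DForm E M a),
    (∀ i, SmoothFormOn (s i) U) ∧
    ∀ x ∈ U, LinearIndependent ℝ (fun i => s i x) ∧ S x = Submodule.span ℝ (range fun i => s i x)

/-- The family of subsets `G x ⊆ ⋀^a T_x^* M` is a smooth affine subbundle of `⋀^a M`. -/
def IsAffineSubbundle {a : ℕ} (G : ∀ x : M, Set (FormAt E x a)) : Prop :=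
  ∀ x₀ : M, ∃ U : Set M, IsOpen U ∧ x₀ ∈ U ∧
    ∃ (r : ℕ) (s₀ : DForm E M a) (s : Fin r → DForm E M a),
      SmoothFormOn s₀ U ∧ (∀ i, SmoothFormOn (s i) U) ∧
      ∀ x ∈ U, LinearIndependent ℝ (fun i => s i x) ∧
        G x = {β | β - s₀ x ∈ Submodule.span ℝ (range fun i => s i x)}

/-- The annihilator `{v ∈ T_x M : ι_v θ = 0 for all θ ∈ S¹_x}`. -/
def annihilator {x : M} (S₁ : Submodule ℝ (FormAt E x 1)) : Submodule ℝ (Tan E x) where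
  carrier := {v | ∀ θ ∈ S₁, θ (fun _ => v) = 0}
  add_mem' := by
    intro v w hv hw θ hθ
    have h := θ.toMultilinearMap.map_update_add (fun _ => (0 : Tan E x)) 0 v w
    have e : ∀ z : Tan E x, Function.update (fun _ : Fin 1 => (0 : Tan E x)) 0 z = fun _ => z := by
      intro z; funext i; rw [Subsingleton.elim i 0]; simp
    simp only [e] at h
    exact h.trans (by
      have h1 := hv θ hθ
      have h2 := hw θ hθ
      change θ (fun _ => v) + θ (fun _ => w) = 0
      rw [h1, h2, add_zero])
  zero_mem' := by
    intro θ _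
    exact θ.map_coord_zero (m := fun _ => 0) 0 rfl
  smul_mem' := by
    intro c v hv θ hθ
    have h := θ.toMultilinearMap.map_update_smul (fun _ => (0 : Tan E x)) 0 c v
    have e : ∀ z : Tan E x, Function.update (fun _ : Fin 1 => (0 : Tan E x)) 0 z = fun _ => z := by
      intro z; funext i; rw [Subsingleton.elim i 0]; simp
    simp only [e] at h
    exact h.trans (by
      have h1 := hv θ hθ
      change c • θ (fun _ => v) = 0
      rw [h1, smul_zero])

/-- The section `s` of `TM / K` is smooth on `U`: locally, it is the class of a smooth vector
field. -/
def SmoothModOn [IsManifold 𝓘(ℝ, E) ∞ M] (K : ∀ x : M, Submodule ℝ (Tan E x)) (s : ∀ x : M, Tan E x ⧸ K x) (U : Set M) :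
    Prop :=
  ∀ x₀ ∈ U, ∃ V : Set M, IsOpen V ∧ x₀ ∈ V ∧ ∃ Y : ∀ x : M, Tan E x,
    SmoothFieldOn Y V ∧ ∀ x ∈ V, (K x).mkQ (Y x) = s x

/-- `(S¹)^{∧ a}`: the span of the products `θ₁ ∧ ⋯ ∧ θ_a` with `θᵢ ∈ S¹`. -/
def wedgePower {x : M} (S₁ : Submodule ℝ (FormAt E x 1)) (a : ℕ) : Submodule ℝ (FormAt E x a) :=
  Submodule.span ℝ {β | ∃ θ : Fin a → FormAt E x 1, (∀ i, θ i ∈ S₁) ∧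
    ∀ v : Fin a → Tan E x, β v = Matrix.det (Matrix.of fun i j => θ i (fun _ => v j))}

end Forms

/-! ## Graded Dirac structures -/

section Dirac

variable (E : Type*) [NormedAddCommGroup E] [NormedSpace ℝ E]
  (M : Type*) [TopologicalSpace M] [ChartedSpace E M] [IsManifold 𝓘(ℝ, E) ∞ M]

/-- A regular almost graded Dirac structure of order `n = k + 1` on `M`: vector subbundles
`S¹, …, Sⁿ` of the bundles of forms with `S^a = ι_{TM} S^{a+1}`, and a skew-symmetric vector
bundle map `♯ₙ : Sⁿ → TM / K₁`, where `K₁` is the annihilator of `S¹`.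

As for Dirac structures, "almost" means that integrability is not required. The map `♯ₙ` determines
the maps `♯_a : S^a → ⋀^{n+1-a} TM / K_{n+1-a}` of lower degree, by
`♯_a (ι_U α) = ♯ₙ(α) ∧ U + K_{n+1-a}`. The values `S a` for `a = 0` and `a > n` are irrelevant. -/
structure AlmostGradedDirac (k : ℕ) where
  /-- the subbundles `S^a` -/
  S : ∀ (a : ℕ) (x : M), Submodule ℝ (FormAt E x a)
  isSubbundle : ∀ a, 1 ≤ a → a ≤ k + 1 → IsSubbundle (S a)
  contraction : ∀ a, 1 ≤ a → a ≤ k → ∀ x : M,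
    S a x = Submodule.span ℝ {β | ∃ (u : Tan E x), ∃ α ∈ S (a + 1) x, β = contr u α}
  /-- the map `♯ₙ` -/
  sharp : ∀ x : M, S (k + 1) x →ₗ[ℝ] Tan E x ⧸ annihilator (S 1 x)
  sharp_smooth : ∀ (U : Set M), IsOpen U → ∀ (α : DForm E M (k + 1)), SmoothFormOn α U →
    (∀ x ∈ U, α x ∈ S (k + 1) x) → ∀ s : ∀ x : M, Tan E x ⧸ annihilator (S 1 x),
    (∀ x ∈ U, ∀ h : α x ∈ S (k + 1) x, s x = sharp x ⟨α x, h⟩) →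
    SmoothModOn (fun x => annihilator (S 1 x)) s U
  skew : ∀ (x : M) (α β : S (k + 1) x) (u v : Tan E x),
    (annihilator (S 1 x)).mkQ u = sharp x α → (annihilator (S 1 x)).mkQ v = sharp x β →
    contr u β.1 = - contr v α.1

end Dirac

section Dynamics

variable {E : Type*} [NormedAddCommGroup E] [NormedSpace ℝ E]
  {M : Type*} [TopologicalSpace M] [ChartedSpace E M] [IsManifold 𝓘(ℝ, E) ∞ M] {k : ℕ}

/-- `K₁`, the annihilator of `S¹`. -/
abbrev K₁ (D : AlmostGradedDirac E M k) (x : M) : Submodule ℝ (Tan E x) := annihilator (D.S 1 x)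

/-- A representative in `T_x M` of a class modulo `K₁`. -/
def rep (D : AlmostGradedDirac E M k) {x : M} (q : Tan E x ⧸ K₁ D x) : Tan E x :=
  Function.surjInv (K₁ D x).mkQ_surjective q

/-- `ι_{♯̃₁(β)} α`, for `β ∈ (S¹)^{∧(n+1)}` and `α ∈ Sⁿ`.

The element `♯̃₁(β)` of `⋀ⁿ T*M ⊗ (⋀ⁿ TM / Kₙ) = Hom (Sⁿ, ⋀ⁿ T*M)` is the one with
`ι_{♯̃₁(β)} α = ι_{♯ₙ(α)} β`. As `K₁` annihilates `β`, any representative of `♯ₙ(α)` will do. -/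
def sharpOne (D : AlmostGradedDirac E M k) {x : M} (β : FormAt E x (k + 1 + 1))
    (α : D.S (k + 1) x) : FormAt E x (k + 1) :=
  contr (rep D (D.sharp x α)) β

/-- `ι_L α`, for `L ∈ T*M ⊗ TM / K₁` and an `a`-form `α` that is annihilated by `K₁`.
For `L = θ ⊗ (u + K₁)` this is `θ ∧ ι_u α`; in general it is
`(v₁, …, v_a) ↦ ∑ᵢ α (v₁, …, L vᵢ, …, v_a)`, for any representatives of `L vᵢ`. -/
def contrMod (D : AlmostGradedDirac E M k) {x : M} {a : ℕ}
    (L : Tan E x →ₗ[ℝ] Tan E x ⧸ K₁ D x) (α : FormAt E x a) (v : Fin a → Tan E x) : ℝ :=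
  ∑ i, α (Function.update v i (rep D (L (v i))))

/-- `L ∈ T*M ⊗ TM / K₁` is a possible value of `♯̃ₙ(β)`: `ι_L α = ι_{♯̃₁(β)} α` for all
`α ∈ Sⁿ`. -/
def IsExtensionValue (D : AlmostGradedDirac E M k) {x : M} (β : FormAt E x (k + 1 + 1))
    (L : Tan E x →ₗ[ℝ] Tan E x ⧸ K₁ D x) : Prop :=
  ∀ (α : D.S (k + 1) x) (v : Fin (k + 1) → Tan E x), contrMod D L α.1 v = sharpOne D β α v

/-- The fibre at `x` of `S^{n+1}[n]`. -/
def SExt (D : AlmostGradedDirac E M k) (x : M) : Set (FormAt E x (k + 1 + 1)) :=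
  {β | β ∈ wedgePower (D.S 1 x) (k + 1 + 1) ∧
    ∃ L : Tan E x →ₗ[ℝ] Tan E x ⧸ K₁ D x, IsExtensionValue D β L}

/-- A Hamiltonian form of degree `n - 1 = k` on `U`. -/
def IsHamiltonianForm (D : AlmostGradedDirac E M k) (U : Set M) (α : DForm E M k) : Prop :=
  SmoothFormOn α U ∧ ∀ x ∈ U, extD α x ∈ D.S (k + 1) x

/-- Locally, `Sⁿ` is spanned by exterior derivatives of Hamiltonian forms. -/
def LocallySpannedByHamiltonianForms (D : AlmostGradedDirac E M k) : Prop :=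
  ∀ x₀ : M, ∃ U : Set M, IsOpen U ∧ x₀ ∈ U ∧ ∃ (r : ℕ) (α : Fin r → DForm E M k),
    (∀ i, IsHamiltonianForm D U (α i)) ∧
    ∀ x ∈ U, D.S (k + 1) x = Submodule.span ℝ (range fun i => extD (α i) x)

variable {F : Type*} [NormedAddCommGroup F] [NormedSpace ℝ F]
  {X : Type*} [TopologicalSpace X] [ChartedSpace F X]

/-- The differential of `τ` at `x`. -/
abbrev dmap (E F : Type*) [NormedAddCommGroup E] [NormedSpace ℝ E] [NormedAddCommGroup F]
    [NormedSpace ℝ F] {M X : Type*} [TopologicalSpace M] [ChartedSpace E M] [TopologicalSpace X]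
    [ChartedSpace F X] (τ : M → X) (x : M) : Tan E x →L[ℝ] Tan F (τ x) :=
  mfderiv 𝓘(ℝ, E) 𝓘(ℝ, F) τ x

/-- `α` is `r`-horizontal: it vanishes as soon as `a + 1 - r` of its arguments are vertical. -/
def IsHorizontal (F : Type*) [NormedAddCommGroup F] [NormedSpace ℝ F]
    {X : Type*} [TopologicalSpace X] [ChartedSpace F X] (τ : M → X) {x : M} {a : ℕ} (r : ℕ)
    (α : FormAt E x a) : Prop :=
  ∀ (v : Fin a → Tan E x) (s : Finset (Fin a)), a + 1 ≤ r + s.card →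
    (∀ i ∈ s, dmap E F τ x (v i) = 0) → α v = 0

/-- `α` is semi-basic: it vanishes as soon as one of its arguments is vertical. -/
def IsSemibasic (F : Type*) [NormedAddCommGroup F] [NormedSpace ℝ F]
    {X : Type*} [TopologicalSpace X] [ChartedSpace F X] (τ : M → X) {x : M} {a : ℕ}
    (α : FormAt E x a) : Prop :=
  ∀ v : Fin a → Tan E x, (∃ i, dmap E F τ x (v i) = 0) → α v = 0

/-- `D` is fibered over `X` by `τ`, where `n = dim X`: `S^a` consists of `(a-1)`-horizontal forms
and contains all semi-basic `a`-forms. -/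
structure IsFibered (D : AlmostGradedDirac E M k) (F : Type*) [NormedAddCommGroup F]
    [NormedSpace ℝ F] {X : Type*} [TopologicalSpace X] [ChartedSpace F X] (τ : M → X) : Prop where
  smooth : ContMDiff 𝓘(ℝ, E) 𝓘(ℝ, F) ∞ τ
  surjective : Function.Surjective τ
  submersion : ∀ x : M, Function.Surjective (dmap E F τ x)
  dim_base : Module.finrank ℝ F = k + 1
  horizontal : ∀ a, 1 ≤ a → a ≤ k + 1 → ∀ (x : M), ∀ α ∈ D.S a x, IsHorizontal F τ (a - 1) α
  semibasic_mem : ∀ a, 1 ≤ a → a ≤ k + 1 → ∀ (x : M) (α : FormAt E x a),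
    IsSemibasic F τ α → α ∈ D.S a x

/-- `-♯̃₁(β) + 𝟙ₙ`, a form with values in `⋀ⁿ TM / Kₙ = (Sⁿ)*`, is semi-basic. -/
def IsSemibasicShift (D : AlmostGradedDirac E M k) (F : Type*) [NormedAddCommGroup F]
    [NormedSpace ℝ F] {X : Type*} [TopologicalSpace X] [ChartedSpace F X] (τ : M → X) {x : M}
    (β : FormAt E x (k + 1 + 1)) : Prop :=
  ∀ α : D.S (k + 1) x, IsSemibasic F τ (- sharpOne D β α + α.1)

/-- The fibre at `x` of `Γ = {β ∈ S^{n+1}[n] : -♯̃₁(β) + 𝟙ₙ is semi-basic}`. -/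
def Γfib (D : AlmostGradedDirac E M k) (F : Type*) [NormedAddCommGroup F]
    [NormedSpace ℝ F] {X : Type*} [TopologicalSpace X] [ChartedSpace F X] (τ : M → X) (x : M) :
    Set (FormAt E x (k + 1 + 1)) :=
  {β | β ∈ SExt D x ∧ IsSemibasicShift D F τ β}

/-- A Hamiltonian: a smooth `n`-form `H` on `M` with `dH` in `S^{n+1}[n]`, such that
`-♯̃₁(dH) + 𝟙ₙ` is semi-basic and `ι_{-♯̃₁(dH) + 𝟙ₙ} φ = φ` for all semi-basic `n`-forms `φ`. -/
structure IsHamiltonian (D : AlmostGradedDirac E M k) (F : Type*) [NormedAddCommGroup F]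
    [NormedSpace ℝ F] {X : Type*} [TopologicalSpace X] [ChartedSpace F X] (τ : M → X)
    (H : DForm E M (k + 1)) : Prop where
  smooth : SmoothFormOn H univ
  extD_mem : ∀ x, extD H x ∈ SExt D x
  semibasic : ∀ x, IsSemibasicShift D F τ (extD H x)
  identity : ∀ (x : M) (φ : D.S (k + 1) x), IsSemibasic F τ φ.1 →
    - sharpOne D (extD H x) φ + φ.1 = φ.1

theorem IsHamiltonian.extD_mem_Γfib {D : AlmostGradedDirac E M k} {τ : M → X}
    {H : DForm E M (k + 1)} (hH : IsHamiltonian D F τ H) (x : M) : extD H x ∈ Γfib D F τ x :=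
  ⟨hH.extD_mem x, hH.semibasic x⟩

/-- The horizontal lift `h_x : T_{τ x} X → T_x M` of an Ehresmann connection on `τ : M → X`.
It is smooth: the horizontal part `h (dτ Y)` of a smooth vector field `Y` is smooth. -/
structure HorizontalLift (E F : Type*) [NormedAddCommGroup E] [NormedSpace ℝ E]
    [NormedAddCommGroup F] [NormedSpace ℝ F] {M X : Type*} [TopologicalSpace M] [ChartedSpace E M]
    [IsManifold 𝓘(ℝ, E) ∞ M] [TopologicalSpace X] [ChartedSpace F X] (τ : M → X) where
  /-- the lift at a point -/
  lift : ∀ x : M, Tan F (τ x) →L[ℝ] Tan E x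
  dmap_lift : ∀ (x : M) (z : Tan F (τ x)), dmap E F τ x (lift x z) = z
  smooth : ∀ U : Set M, IsOpen U → ∀ Y : ∀ x : M, Tan E x, SmoothFieldOn Y U →
    SmoothFieldOn (fun x => lift x (dmap E F τ x (Y x))) U

/-- A horizontal lift modulo `K₁`: a smooth vector bundle map `τ* TX → TM / K₁` whose composition
with the projection `TM / K₁ → τ* TX` is the identity. -/
structure HorizontalLiftMod (D : AlmostGradedDirac E M k) (F : Type*) [NormedAddCommGroup F]
    [NormedSpace ℝ F] {X : Type*} [TopologicalSpace X] [ChartedSpace F X] (τ : M → X) where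
  /-- the lift at a point -/
  lift : ∀ x : M, Tan F (τ x) →ₗ[ℝ] Tan E x ⧸ K₁ D x
  dmap_lift : ∀ (x : M) (z : Tan F (τ x)) (w : Tan E x), (K₁ D x).mkQ w = lift x z →
    dmap E F τ x w = z
  smooth : ∀ U : Set M, IsOpen U → ∀ Y : ∀ x : M, Tan E x, SmoothFieldOn Y U →
    SmoothModOn (K₁ D) (fun x => lift x (dmap E F τ x (Y x))) U

/-- The horizontal lift `h` coincides with `g` modulo `K₁`. -/
def HorizontalLift.CoincidesWith {D : AlmostGradedDirac E M k} {τ : M → X}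
    (h : HorizontalLift E F τ) (g : HorizontalLiftMod D F τ) : Prop :=
  ∀ (x : M) (z : Tan F (τ x)), (K₁ D x).mkQ (h.lift x z) = g.lift x z

/-- The connection with horizontal lift `h` solves the Hamilton-De Donder-Weyl equations of `H`:
`h^*(dα) = dα + {α, H}`, where `{α, H} = -ι_{♯̃₁(dH)} dα`, for all Hamiltonian `(n-1)`-forms `α`
on open subsets of `M`. Here `(h^* φ)(v₁, …, vₙ) = φ (h (dτ v₁), …, h (dτ vₙ))`. -/
def SolvesHDW (D : AlmostGradedDirac E M k) {τ : M → X} (H : DForm E M (k + 1))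
    (h : HorizontalLift E F τ) : Prop :=
  ∀ (U : Set M), IsOpen U → ∀ α : DForm E M k, IsHamiltonianForm D U α →
    ∀ x ∈ U, ∀ hx : extD α x ∈ D.S (k + 1) x,
      (extD α x).compContinuousLinearMap ((h.lift x).comp (dmap E F τ x)) =
        extD α x - sharpOne D (extD H x) ⟨extD α x, hx⟩

/-- A vertical valued extension `♯̃ₙ : Γ → T*M ⊗ TM / K₁`: a smooth, fibrewise affine map with
`ι_{♯̃ₙ(β)} α = ι_{♯̃₁(β)} α` for all `α ∈ Sⁿ`, and whose values have vertical values. -/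
structure VerticalExtension (D : AlmostGradedDirac E M k) (F : Type*) [NormedAddCommGroup F]
    [NormedSpace ℝ F] {X : Type*} [TopologicalSpace X] [ChartedSpace F X] (τ : M → X) where
  /-- the map `♯̃ₙ` -/
  toFun : ∀ x : M, Γfib D F τ x → (Tan E x →ₗ[ℝ] Tan E x ⧸ K₁ D x)
  affine : ∀ (x : M) (β₁ β₂ β₃ : Γfib D F τ x) (t : ℝ),
    β₃.1 = t • β₁.1 + (1 - t) • β₂.1 →
    toFun x β₃ = t • toFun x β₁ + (1 - t) • toFun x β₂
  smooth : ∀ U : Set M, IsOpen U → ∀ B : DForm E M (k + 1 + 1), SmoothFormOn B U →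
    (∀ x ∈ U, B x ∈ Γfib D F τ x) → ∀ Y : ∀ x : M, Tan E x, SmoothFieldOn Y U →
    ∀ s : ∀ x : M, Tan E x ⧸ K₁ D x,
      (∀ x ∈ U, ∀ hB : B x ∈ Γfib D F τ x, s x = toFun x ⟨B x, hB⟩ (Y x)) →
      SmoothModOn (K₁ D) s U
  isExtension : ∀ (x : M) (β : Γfib D F τ x), IsExtensionValue D β.1 (toFun x β)
  vertical : ∀ (x : M) (β : Γfib D F τ x) (v w : Tan E x),
    (K₁ D x).mkQ w = toFun x β v → dmap E F τ x w = 0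

/-- The affine maps `γ` from Hamiltonians to horizontal lifts modulo `K₁` such that
(i) `γ_H` at `x` depends only on `dH` at `x`, and
(ii) every connection whose horizontal lift coincides with `γ_H` modulo `K₁` solves the
Hamilton-De Donder-Weyl equations of `H`. -/
structure SolutionMap (D : AlmostGradedDirac E M k) (F : Type*) [NormedAddCommGroup F]
    [NormedSpace ℝ F] {X : Type*} [TopologicalSpace X] [ChartedSpace F X] (τ : M → X) where
  /-- the map `γ` -/
  toFun : {H : DForm E M (k + 1) // IsHamiltonian D F τ H} → HorizontalLiftMod D F τ
  affine : ∀ (H₁ H₂ H₃ : {H : DForm E M (k + 1) // IsHamiltonian D F τ H}) (t : ℝ),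
    H₃.1 = t • H₁.1 + (1 - t) • H₂.1 →
    ∀ x, (toFun H₃).lift x = t • (toFun H₁).lift x + (1 - t) • (toFun H₂).lift x
  pointwise : ∀ (H₁ H₂ : {H : DForm E M (k + 1) // IsHamiltonian D F τ H}) (x : M),
    extD H₁.1 x = extD H₂.1 x → (toFun H₁).lift x = (toFun H₂).lift x
  solves : ∀ (H : {H : DForm E M (k + 1) // IsHamiltonian D F τ H}) (h : HorizontalLift E F τ),
    h.CoincidesWith (toFun H) → SolvesHDW D H.1 h

end Dynamics

end GradedDirac

end

/-! Write L for ♯̃ₙ(dH) at a point; the correspondence is γ_H ∘ dτ = 1 - L modulo K₁. Everything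
rests on (n-1)-horizontality: two vertical arguments kill every form of Sⁿ. If L is vertical valued,
the expansion of α(v₁ - Lv₁, …, vₙ - Lvₙ) therefore stops at first order and equals α - ι_L α
(`IsFibered.apply_sub_vertical`). So for a lift h with h ∘ dτ = 1 - L modulo K₁, the Hamilton–De
Donder–Weyl equation on dα is precisely the extension equation ι_L dα = ι_{♯̃₁(dH)} dα.

From extensions to solution maps, 1 - L must descend along dτ, that is, vanish on vertical vectors.
For vertical w, semi-basicness of -♯̃₁(dH) + 𝟙ₙ gives α(…, w, …) = (ι_L α)(…, w, …), and on the
right only the term containing Lw survives. So w - Lw is annihilated by all of Sⁿ and hence lies in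
K₁ (`IsFibered.apply_vertical`, `mem_K₁_of_forall_apply_eq_zero`).

Conversely, γ gives L = 1 - γ_H ∘ dτ for any H with dH = β at the point; condition 1 makes this well
defined. Condition 2 speaks only of genuine connections, so one lying over γ_H has to be built with
a partition of unity (`exists_horizontalLift_coincidesWith`); its equations give the extension
equation on the dα that span Sⁿ. For smoothness, differentials of Hamiltonians form a local affine
frame of Γ, a smooth section of Γ has smooth coefficients in it (`exists_smooth_coefficients`), and
affinity (`exists_affine_sum`) transports these coefficients to L. -/

namespace GradedDirac

/-! ### Expansion of multilinear maps -/

section Multilinear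

/-- A multilinear map that vanishes as soon as two of its arguments lie in `V` is affine in
perturbations with values in `V`. -/
theorem multilinear_map_add_of_vanish_two {V : Type*} [AddCommGroup V] [Module ℝ V] {a : ℕ}
    (f : MultilinearMap ℝ (fun _ : Fin a => V) ℝ) (m h : Fin a → V)
    (hf : ∀ s : Finset (Fin a), 2 ≤ s.card → f (s.piecewise h m) = 0) :
    f (m + h) = f m + ∑ i, f (Function.update m i (h i)) := by
  rw [MultilinearMap.map_add_eq_map_add_linearDeriv_add, MultilinearMap.linearDeriv_apply,
    Finset.sum_eq_zero fun s hs => hf s (Finset.mem_filter.1 hs).2, add_zero]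

/-- A multilinear map that vanishes as soon as one of its arguments lies in `K` only depends on the
classes of its arguments modulo `K`. -/
theorem multilinear_eq_of_sub_mem {V : Type*} [AddCommGroup V] [Module ℝ V] {a : ℕ}
    (f : MultilinearMap ℝ (fun _ : Fin a => V) ℝ) (K : Submodule ℝ V)
    (hf : ∀ m i, m i ∈ K → f m = 0) (m m' : Fin a → V) (hm : ∀ i, m i - m' i ∈ K) :
    f m = f m' := by
  have e : m = m' + (m - m') := by abel
  rw [e, multilinear_map_add_of_vanish_two, Finset.sum_eq_zero, add_zero]
  · intro i _
    exact hf _ i (by simpa using hm i)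
  · intro s hs
    obtain ⟨i, hi⟩ := Finset.card_pos.1 (by omega : 0 < s.card)
    exact hf _ i (by simpa [hi] using hm i)

end Multilinear

/-! ### Pointwise algebra of Sⁿ, K₁ and the contractions -/

section Pointwise

variable {E : Type*} [NormedAddCommGroup E] [NormedSpace ℝ E]
  {M : Type*} [TopologicalSpace M] [ChartedSpace E M]

theorem contr_apply_tail {x : M} {a : ℕ} (β : FormAt E x (a + 1)) (m : Fin (a + 1) → Tan E x) :
    contr (m 0) β (fun i => m i.succ) = β m := by
  rw [contr_apply]
  congr 1
  funext i
  refine Fin.cases rfl (fun j => rfl) i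

theorem contr_add_left {x : M} {a : ℕ} (u v : Tan E x) (β : FormAt E x (a + 1)) :
    contr (u + v) β = contr u β + contr v β := by
  ext m
  exact congrArg (fun f => f m) (map_add β.toAlternatingMap.curryLeft u v)

theorem contr_smul_left {x : M} {a : ℕ} (c : ℝ) (u : Tan E x) (β : FormAt E x (a + 1)) :
    contr (c • u) β = c • contr u β := by
  ext m
  exact congrArg (fun f => f m) (map_smul β.toAlternatingMap.curryLeft c u)

theorem wedgePower_apply_eq_zero {x : M} {S₁ : Submodule ℝ (FormAt E x 1)} {a : ℕ}
    {β : FormAt E x a} (hβ : β ∈ wedgePower S₁ a) {m : Fin a → Tan E x} {i : Fin a}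
    (hi : m i ∈ annihilator S₁) : β m = 0 := by
  induction hβ using Submodule.span_induction with
  | mem β h =>
    obtain ⟨θ, hθ, h⟩ := h
    rw [h]
    exact Matrix.det_eq_zero_of_column_eq_zero i fun j => hi (θ j) (hθ j)
  | zero => rfl
  | add β₁ β₂ _ _ h₁ h₂ =>
    change β₁ m + β₂ m = 0
    rw [h₁, h₂, add_zero]
  | smul c β _ h =>
    change c • β m = 0
    rw [h, smul_zero]

variable [IsManifold 𝓘(ℝ, E) ∞ M] {k : ℕ} (D : AlmostGradedDirac E M k)

/-- Induction on the degree: contracting the first argument leaves a form of the next lower S, which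
handles every later slot. The first slot is exchanged with the second by antisymmetry. -/
theorem S_apply_eq_zero (x : M) (a : ℕ) (ha : 1 ≤ a) (hak : a ≤ k + 1) :
    ∀ α ∈ D.S a x, ∀ (m : Fin a → Tan E x) (i : Fin a), m i ∈ K₁ D x → α m = 0 := by
  induction a, ha using Nat.le_induction with
  | base =>
    intro α hα m i hi
    have : m = fun _ => m i := by funext j; rw [Subsingleton.elim j i]
    rw [this]
    exact hi α hα
  | succ a ha ih =>
    have key : ∀ α ∈ D.S (a + 1) x, ∀ (m : Fin (a + 1) → Tan E x) (i : Fin a),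
        m i.succ ∈ K₁ D x → α m = 0 := by
      intro α hα m i hi
      rw [← contr_apply_tail]
      refine ih (by omega) _ ?_ _ i hi
      rw [D.contraction a ha (by omega) x]
      exact Submodule.subset_span ⟨_, α, hα, rfl⟩
    intro α hα m i hi
    induction i using Fin.cases with
    | succ i => exact key α hα m i hi
    | zero =>
      -- Since a ≥ 1, the form has at least two arguments, so there is a second slot to swap with.
      obtain ⟨b, rfl⟩ : ∃ b, a = b + 1 := ⟨a - 1, by omega⟩
      have h01 : (0 : Fin (b + 2)) ≠ (0 : Fin (b + 1)).succ := (Fin.succ_ne_zero _).symm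
      have h := α.toAlternatingMap.map_swap m h01
      have h' := key α hα (m ∘ Equiv.swap 0 (0 : Fin (b + 1)).succ) 0
        (by simpa only [Function.comp_apply, Equiv.swap_apply_right] using hi)
      exact neg_eq_zero.1 (h.symm.trans h')

/-- A vector on which all forms of `Sⁿ` vanish lies in `K₁`. -/
theorem mem_K₁_of_forall_apply_eq_zero {x : M} {u : Tan E x}
    (hu : ∀ α ∈ D.S (k + 1) x, ∀ (m : Fin (k + 1) → Tan E x) (i : Fin (k + 1)), m i = u → α m = 0) :
    u ∈ K₁ D x := by
  have h1 : ∀ α ∈ D.S 1 x, ∀ (m : Fin 1 → Tan E x) (i : Fin 1), m i = u → α m = 0 := by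
    -- Descend from degree n to degree 1: S^a is spanned by contractions of S^(a+1), and slot i of
    -- ι_w α is slot i + 1 of α.
    refine Nat.decreasingInduction' (m := 1) (n := k + 1)
      (P := fun a => ∀ α ∈ D.S a x, ∀ (m : Fin a → Tan E x) (i : Fin a), m i = u → α m = 0)
      ?_ (by omega) hu
    intro a hak ha ih α hα m i hi
    rw [D.contraction a ha (by omega) x] at hα
    induction hα using Submodule.span_induction with
    | mem β h =>
      obtain ⟨w, α, hα, rfl⟩ := h
      rw [contr_apply]
      exact ih α hα _ i.succ (by simpa using hi)
    | zero => rfl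
    | add β₁ β₂ _ _ h₁ h₂ =>
      change β₁ m + β₂ m = 0
      rw [h₁, h₂, add_zero]
    | smul c β _ h =>
      change c • β m = 0
      rw [h, smul_zero]
  intro θ hθ
  exact h1 θ hθ _ 0 rfl

@[simp] theorem mkQ_rep {x : M} (q : Tan E x ⧸ K₁ D x) : (K₁ D x).mkQ (rep D q) = q :=
  Function.surjInv_eq _ q

@[simp] theorem mk_rep {x : M} (q : Tan E x ⧸ K₁ D x) :
    (Submodule.Quotient.mk (rep D q) : Tan E x ⧸ K₁ D x) = q :=
  mkQ_rep D q

variable {D}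

theorem sub_mem_of_mkQ_eq {x : M} {u v : Tan E x} (h : (K₁ D x).mkQ u = (K₁ D x).mkQ v) :
    u - v ∈ K₁ D x :=
  (Submodule.Quotient.eq _).1 h

theorem S_apply_congr {x : M} {a : ℕ} (ha : 1 ≤ a) (hak : a ≤ k + 1) {α : FormAt E x a}
    (hα : α ∈ D.S a x) {m m' : Fin a → Tan E x}
    (h : ∀ i, (K₁ D x).mkQ (m i) = (K₁ D x).mkQ (m' i)) : α m = α m' :=
  multilinear_eq_of_sub_mem α.toMultilinearMap (K₁ D x) (S_apply_eq_zero D x a ha hak α hα) m m'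
    fun i => sub_mem_of_mkQ_eq (h i)

theorem S_apply_update_congr {x : M} {a : ℕ} (ha : 1 ≤ a) (hak : a ≤ k + 1) {α : FormAt E x a}
    (hα : α ∈ D.S a x) (m : Fin a → Tan E x) (i : Fin a) {u v : Tan E x}
    (h : (K₁ D x).mkQ u = (K₁ D x).mkQ v) :
    α (Function.update m i u) = α (Function.update m i v) := by
  refine S_apply_congr ha hak hα fun j => ?_
  by_cases hj : j = i
  · subst hj; simpa using h
  · simp [hj]

/-- K₁ annihilates β, so the arbitrary choice made by `rep` is immaterial. Choosing lifts that add
and scale then gives linearity in α. -/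
theorem sharpOne_apply {x : M} {β : FormAt E x (k + 1 + 1)}
    (hβ : β ∈ wedgePower (D.S 1 x) (k + 1 + 1)) (α : D.S (k + 1) x) {u : Tan E x}
    (hu : (K₁ D x).mkQ u = D.sharp x α) : sharpOne D β α = contr u β := by
  ext v
  change β (Matrix.vecCons _ v) = β (Matrix.vecCons u v)
  refine multilinear_eq_of_sub_mem β.toMultilinearMap (K₁ D x)
    (fun m i hi => wedgePower_apply_eq_zero hβ hi) _ _ fun i => ?_
  induction i using Fin.cases with
  | zero => exact sub_mem_of_mkQ_eq (by simp [hu])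
  | succ i => simp

theorem sharpOne_add {x : M} {β : FormAt E x (k + 1 + 1)}
    (hβ : β ∈ wedgePower (D.S 1 x) (k + 1 + 1)) (α₁ α₂ : D.S (k + 1) x) :
    sharpOne D β (α₁ + α₂) = sharpOne D β α₁ + sharpOne D β α₂ := by
  rw [sharpOne_apply hβ (α₁ + α₂) (u := rep D (D.sharp x α₁) + rep D (D.sharp x α₂))
    (by simp only [map_add, mkQ_rep]), contr_add_left]
  rfl

theorem sharpOne_smul {x : M} {β : FormAt E x (k + 1 + 1)}
    (hβ : β ∈ wedgePower (D.S 1 x) (k + 1 + 1)) (c : ℝ) (α : D.S (k + 1) x) :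
    sharpOne D β (c • α) = c • sharpOne D β α := by
  rw [sharpOne_apply hβ (c • α) (u := c • rep D (D.sharp x α))
    (by simp only [map_smul, mkQ_rep]), contr_smul_left]
  rfl

theorem sharpOne_zero {x : M} {β : FormAt E x (k + 1 + 1)}
    (hβ : β ∈ wedgePower (D.S 1 x) (k + 1 + 1)) : sharpOne D β 0 = 0 := by
  simpa using sharpOne_smul hβ 0 0

/-- `♯̃₁` is linear. -/
theorem sharpOne_combination {x : M} (β₁ β₂ : FormAt E x (k + 1 + 1)) (s t : ℝ)
    (α : D.S (k + 1) x) :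
    sharpOne D (s • β₁ + t • β₂) α = s • sharpOne D β₁ α + t • sharpOne D β₂ α := rfl

/-- `ι_L α` is linear in `L`. -/
theorem contrMod_combination {x : M} (L₁ L₂ : Tan E x →ₗ[ℝ] Tan E x ⧸ K₁ D x) (s t : ℝ)
    {α : FormAt E x (k + 1)} (hα : α ∈ D.S (k + 1) x) (v : Fin (k + 1) → Tan E x) :
    contrMod D (s • L₁ + t • L₂) α v = s • contrMod D L₁ α v + t • contrMod D L₂ α v := by
  unfold contrMod
  rw [Finset.smul_sum, Finset.smul_sum, ← Finset.sum_add_distrib]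
  refine Finset.sum_congr rfl fun i _ => ?_
  -- `rep` is not linear; the representative of the combination is traded for the combination of the
  -- representatives.
  rw [S_apply_update_congr (by omega) le_rfl hα v i
    (v := s • rep D (L₁ (v i)) + t • rep D (L₂ (v i))) (by simp)]
  simp [ContinuousAlternatingMap.map_update_add, ContinuousAlternatingMap.map_update_smul]

/-- The extension equation for a class of forms spanning `Sⁿ` implies it for all of `Sⁿ`. -/
theorem isExtensionValue_of_span {x : M} {β : FormAt E x (k + 1 + 1)}
    (hβ : β ∈ wedgePower (D.S 1 x) (k + 1 + 1)) {L : Tan E x →ₗ[ℝ] Tan E x ⧸ K₁ D x}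
    {A : Set (FormAt E x (k + 1))} (hA : D.S (k + 1) x = Submodule.span ℝ A)
    (h : ∀ (α : D.S (k + 1) x), α.1 ∈ A → ∀ v : Fin (k + 1) → Tan E x,
      contrMod D L α.1 v = sharpOne D β α v) : IsExtensionValue D β L := by
  -- Membership in Sⁿ becomes a separate hypothesis, so that the span induction runs on the bare
  -- form.
  suffices H : ∀ α ∈ Submodule.span ℝ A, ∀ (hα : α ∈ D.S (k + 1) x) (v : Fin (k + 1) → Tan E x),
      contrMod D L α v = sharpOne D β ⟨α, hα⟩ v from
    fun α v => H α.1 (hA ▸ α.2) α.2 v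
  intro α hα
  induction hα using Submodule.span_induction with
  | mem α h' => exact fun hα v => h ⟨α, hα⟩ h' v
  | zero =>
    intro hα v
    have : (⟨0, hα⟩ : D.S (k + 1) x) = 0 := rfl
    rw [this, sharpOne_zero hβ]
    simp [contrMod]
  | add α₁ α₂ h₁ h₂ ih₁ ih₂ =>
    intro hα v
    rw [← hA] at h₁ h₂
    have : (⟨α₁ + α₂, hα⟩ : D.S (k + 1) x) = ⟨α₁, h₁⟩ + ⟨α₂, h₂⟩ := rfl
    rw [this, sharpOne_add hβ]
    change _ = sharpOne D β ⟨α₁, h₁⟩ v + sharpOne D β ⟨α₂, h₂⟩ v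
    rw [← ih₁ h₁, ← ih₂ h₂]
    simp [contrMod, Finset.sum_add_distrib]
  | smul c α h₁ ih₁ =>
    intro hα v
    rw [← hA] at h₁
    have : (⟨c • α, hα⟩ : D.S (k + 1) x) = c • ⟨α, h₁⟩ := rfl
    rw [this, sharpOne_smul hβ]
    change _ = c • sharpOne D β ⟨α, h₁⟩ v
    rw [← ih₁ h₁]
    simp [contrMod, Finset.mul_sum]

end Pointwise

/-! ### Consequences of horizontality for vertical valued tensors -/

section Fibered

variable {E : Type*} [NormedAddCommGroup E] [NormedSpace ℝ E]
  {M : Type*} [TopologicalSpace M] [ChartedSpace E M] [IsManifold 𝓘(ℝ, E) ∞ M]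
  {F : Type*} [NormedAddCommGroup F] [NormedSpace ℝ F]
  {X : Type*} [TopologicalSpace X] [ChartedSpace F X]
  {k : ℕ} {D : AlmostGradedDirac E M k} {τ : M → X}

/-- Pullbacks of covectors by dτ are semi-basic, hence in S¹, and covectors separate the points of
the tangent spaces of X. This inclusion gives ker dτ / K₁ its meaning. -/
theorem IsFibered.dmap_eq_zero_of_mem_K₁ (hτ : IsFibered D F τ) {x : M} {v : Tan E x}
    (hv : v ∈ K₁ D x) : dmap E F τ x v = 0 := by
  by_contra hne
  have : SeparatingDual ℝ (Tan F (τ x)) := inferInstanceAs (SeparatingDual ℝ F)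
  obtain ⟨f, hf⟩ := SeparatingDual.exists_ne_zero (R := ℝ) hne
  let θ : FormAt E x 1 :=
    ContinuousAlternatingMap.ofSubsingleton ℝ (Tan E x) ℝ (0 : Fin 1) (f.comp (dmap E F τ x))
  have hθ : θ ∈ D.S 1 x := by
    refine hτ.semibasic_mem 1 le_rfl (by omega) x θ ?_
    rintro w ⟨i, hi⟩
    rw [Subsingleton.elim i 0] at hi
    change f (dmap E F τ x (w 0)) = 0
    rw [hi, map_zero]
  exact hf (hv θ hθ)

/-- For a = n and r = n - 1, the threshold a + 1 - r equals 2. This cuts every expansion off after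
first order. -/
theorem IsFibered.apply_eq_zero_of_two_le (hτ : IsFibered D F τ) {x : M} {α : FormAt E x (k + 1)}
    (hα : α ∈ D.S (k + 1) x) (m : Fin (k + 1) → Tan E x) (s : Finset (Fin (k + 1)))
    (hs : 2 ≤ s.card) (h : ∀ i ∈ s, dmap E F τ x (m i) = 0) : α m = 0 :=
  hτ.horizontal (k + 1) (by omega) le_rfl x α hα m s (by omega) h

/-- `L` takes values in `ker dτ / K₁`. -/
def IsVerticalValued (D : AlmostGradedDirac E M k) (F : Type*) [NormedAddCommGroup F]
    [NormedSpace ℝ F] {X : Type*} [TopologicalSpace X] [ChartedSpace F X] (τ : M → X) {x : M}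
    (L : Tan E x →ₗ[ℝ] Tan E x ⧸ K₁ D x) : Prop :=
  ∀ v w : Tan E x, (K₁ D x).mkQ w = L v → dmap E F τ x w = 0

theorem IsVerticalValued.dmap_rep {x : M} {L : Tan E x →ₗ[ℝ] Tan E x ⧸ K₁ D x}
    (hL : IsVerticalValued D F τ L) (v : Tan E x) : dmap E F τ x (rep D (L v)) = 0 :=
  hL v _ (mkQ_rep D _)

/-- If `P = 1 - L` modulo `K₁` and `L` is vertical valued, then `P^* α = α - ι_L α`. -/
theorem IsFibered.apply_sub_vertical (hτ : IsFibered D F τ) {x : M}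
    {L : Tan E x →ₗ[ℝ] Tan E x ⧸ K₁ D x} (hL : IsVerticalValued D F τ L)
    {α : FormAt E x (k + 1)} (hα : α ∈ D.S (k + 1) x) (P : Tan E x → Tan E x)
    (hP : ∀ v, (K₁ D x).mkQ (P v) = (K₁ D x).mkQ v - L v) (m : Fin (k + 1) → Tan E x) :
    α (fun i => P (m i)) = α m - contrMod D L α m := by
  -- Modulo K₁ each argument is m i plus a vertical perturbation, and α does not see K₁.
  rw [S_apply_congr (by omega) le_rfl hα (m' := m + fun i => - rep D (L (m i)))
    (fun i => by simp [hP, sub_eq_add_neg])]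
  refine (multilinear_map_add_of_vanish_two α.toMultilinearMap m _ ?_).trans ?_
  · intro s hs
    refine hτ.apply_eq_zero_of_two_le hα _ s hs fun i hi => ?_
    rw [Finset.piecewise_eq_of_mem _ _ _ hi, map_neg, hL.dmap_rep, neg_zero]
  · rw [sub_eq_add_neg, contrMod, ← Finset.sum_neg_distrib]
    congr 1
    refine Finset.sum_congr rfl fun i _ => ?_
    exact α.toMultilinearMap.map_update_neg m i (rep D (L (m i)))

/-- A vertical valued solution `L` of the extension equation over `Γ` is the identity on vertical
vectors. -/
theorem IsFibered.apply_vertical (hτ : IsFibered D F τ) {x : M} {β : FormAt E x (k + 1 + 1)}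
    (hβ : β ∈ Γfib D F τ x) {L : Tan E x →ₗ[ℝ] Tan E x ⧸ K₁ D x}
    (hL : IsVerticalValued D F τ L) (hE : IsExtensionValue D β L) {w : Tan E x}
    (hw : dmap E F τ x w = 0) : L w = (K₁ D x).mkQ w := by
  rw [← mkQ_rep D (L w), eq_comm]
  refine (Submodule.Quotient.eq _).2 (mem_K₁_of_forall_apply_eq_zero D ?_)
  intro α hα m i hi
  -- Here m i = w - `rep` (L w). Semi-basicness is evaluated with the vertical vector w put back in
  -- slot i.
  have h1 := hβ.2 ⟨α, hα⟩ (Function.update m i w) ⟨i, by simpa using hw⟩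
  have h2 : - sharpOne D β ⟨α, hα⟩ (Function.update m i w) + α (Function.update m i w) = 0 := h1
  -- Each summand with j ≠ i has two vertical arguments: w in slot i and the value of L in slot j.
  have h3 : contrMod D L α (Function.update m i w) = α (Function.update m i (rep D (L w))) := by
    unfold contrMod
    rw [Finset.sum_eq_single i]
    · simp
    · intro j _ hj
      refine hτ.apply_eq_zero_of_two_le hα _ {i, j} (by rw [Finset.card_pair hj.symm]) ?_
      intro l hl
      rcases Finset.mem_insert.1 hl with rfl | hl
      · simpa [hj.symm] using hw
      · rw [Finset.mem_singleton] at hl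
        subst hl
        simpa using hL.dmap_rep _
    · simp
  have h4 := hE ⟨α, hα⟩ (Function.update m i w)
  have h5 : α m = α (Function.update m i w) - α (Function.update m i (rep D (L w))) := by
    rw [← ContinuousAlternatingMap.map_update_sub, ← hi, Function.update_eq_self]
  rw [h5, ← h3, h4]
  linarith

end Fibered

/-! ### Chart expressions and the exterior derivative -/

section ExteriorDerivative

variable {E : Type*} [NormedAddCommGroup E] [NormedSpace ℝ E]
  {M : Type*} [TopologicalSpace M] [ChartedSpace E M]

theorem chartRep_combination {a : ℕ} (φ₁ φ₂ : DForm E M a) (s t : ℝ) (x₀ : M) :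
    chartRep (s • φ₁ + t • φ₂) x₀ = s • chartRep φ₁ x₀ + t • chartRep φ₂ x₀ := rfl

theorem isOpen_target_inter_preimage (x₀ : M) {U : Set M} (hU : IsOpen U) :
    IsOpen ((extChartAt 𝓘(ℝ, E) x₀).target ∩ (extChartAt 𝓘(ℝ, E) x₀).symm ⁻¹' U) :=
  (continuousOn_extChartAt_symm x₀).isOpen_inter_preimage (isOpen_extChartAt_target x₀) hU

theorem SmoothFormOn.contDiffAt {a : ℕ} {φ : DForm E M a} {U : Set M} (hφ : SmoothFormOn φ U)
    (hU : IsOpen U) {x₀ : M} {y : E} (hy : y ∈ (extChartAt 𝓘(ℝ, E) x₀).target)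
    (hyU : (extChartAt 𝓘(ℝ, E) x₀).symm y ∈ U) : ContDiffAt ℝ ∞ (chartRep φ x₀) y :=
  (hφ x₀).contDiffAt ((isOpen_target_inter_preimage x₀ hU).mem_nhds ⟨hy, hyU⟩)

theorem SmoothFormOn.mono {a : ℕ} {φ : DForm E M a} {U V : Set M} (hφ : SmoothFormOn φ U)
    (hVU : V ⊆ U) : SmoothFormOn φ V :=
  fun x₀ => (hφ x₀).mono (inter_subset_inter_right _ (preimage_mono hVU))

theorem SmoothFormOn.combination {a : ℕ} {φ₁ φ₂ : DForm E M a} {U : Set M}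
    (h₁ : SmoothFormOn φ₁ U) (h₂ : SmoothFormOn φ₂ U) (s t : ℝ) :
    SmoothFormOn (s • φ₁ + t • φ₂) U := fun x₀ => by
  rw [chartRep_combination]
  exact ((h₁ x₀).const_smul s).add ((h₂ x₀).const_smul t)

theorem SmoothFormOn.sub {a : ℕ} {φ₁ φ₂ : DForm E M a} {U : Set M}
    (h₁ : SmoothFormOn φ₁ U) (h₂ : SmoothFormOn φ₂ U) : SmoothFormOn (φ₁ - φ₂) U := fun x₀ =>
  (h₁ x₀).sub (h₂ x₀)

/-- The exterior derivative is linear on differentiable forms. -/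
theorem extD_combination {a : ℕ} {φ₁ φ₂ : DForm E M a} {U : Set M} (hU : IsOpen U)
    (h₁ : SmoothFormOn φ₁ U) (h₂ : SmoothFormOn φ₂ U) (s t : ℝ) {x : M} (hx : x ∈ U) :
    extD (s • φ₁ + t • φ₂) x = s • extD φ₁ x + t • extD φ₂ x := by
  have d : ∀ {φ : DForm E M a}, SmoothFormOn φ U →
      DifferentiableAt ℝ (chartRep φ x) (extChartAt 𝓘(ℝ, E) x x) := fun h =>
    (h.contDiffAt hU (mem_extChartAt_target x)
      (by rwa [extChartAt_to_inv])).differentiableAt (by simp)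
  unfold extD
  rw [chartRep_combination, extDeriv_add ((d h₁).const_smul s) ((d h₂).const_smul t),
    extDeriv_smul, extDeriv_smul]
  rfl

variable [IsManifold 𝓘(ℝ, E) ∞ M]

/-- The coordinate change between two charts. -/
theorem contDiffAt_coordChange (x₀ x₁ : M) {y : E} (hy : y ∈ (extChartAt 𝓘(ℝ, E) x₀).target)
    (hy₁ : (extChartAt 𝓘(ℝ, E) x₀).symm y ∈ (extChartAt 𝓘(ℝ, E) x₁).source) :
    ContDiffAt ℝ ∞ (extChartAt 𝓘(ℝ, E) x₁ ∘ (extChartAt 𝓘(ℝ, E) x₀).symm) y := by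
  have h := contDiffWithinAt_ext_coord_change (I := 𝓘(ℝ, E)) (n := ∞) x₁ x₀ (y := y)
    (by rw [PartialEquiv.trans_source]; exact ⟨hy, hy₁⟩)
  simpa [← contDiffWithinAt_univ] using h

theorem mdifferentiableAt_extChartAt_symm' (x₀ : M) {y : E}
    (hy : y ∈ (extChartAt 𝓘(ℝ, E) x₀).target) :
    MDifferentiableAt 𝓘(ℝ, E) 𝓘(ℝ, E) (extChartAt 𝓘(ℝ, E) x₀).symm y :=
  ((contMDiffOn_extChartAt_symm (n := ∞) x₀).contMDiffAt
    ((isOpen_extChartAt_target x₀).mem_nhds hy)).mdifferentiableAt (by simp)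

/-- Chart expressions of a form are related by pullback along coordinate changes. -/
theorem chartRep_eq_pullback {a : ℕ} (φ : DForm E M a) (x₀ x₁ : M) {y : E}
    (hy : y ∈ (extChartAt 𝓘(ℝ, E) x₀).target)
    (hy₁ : (extChartAt 𝓘(ℝ, E) x₀).symm y ∈ (extChartAt 𝓘(ℝ, E) x₁).source) :
    chartRep φ x₀ y =
      (chartRep φ x₁ ((extChartAt 𝓘(ℝ, E) x₁ ∘ (extChartAt 𝓘(ℝ, E) x₀).symm) y)
        ).compContinuousLinearMap
        (fderiv ℝ (extChartAt 𝓘(ℝ, E) x₁ ∘ (extChartAt 𝓘(ℝ, E) x₀).symm) y) := by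
  set T := extChartAt 𝓘(ℝ, E) x₁ ∘ (extChartAt 𝓘(ℝ, E) x₀).symm with hT
  have hTd : ContDiffAt ℝ ∞ T y := contDiffAt_coordChange x₀ x₁ hy hy₁
  have hTy : T y ∈ (extChartAt 𝓘(ℝ, E) x₁).target := (extChartAt 𝓘(ℝ, E) x₁).map_source hy₁
  have hp : (extChartAt 𝓘(ℝ, E) x₁).symm (T y) = (extChartAt 𝓘(ℝ, E) x₀).symm y :=
    (extChartAt 𝓘(ℝ, E) x₁).left_inv hy₁
  have hev : (extChartAt 𝓘(ℝ, E) x₀).symm =ᶠ[nhds y] (extChartAt 𝓘(ℝ, E) x₁).symm ∘ T := by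
    filter_upwards [(isOpen_target_inter_preimage x₀ (isOpen_extChartAt_source
      (I := 𝓘(ℝ, E)) x₁)).mem_nhds ⟨hy, hy₁⟩] with z hz
    exact ((extChartAt 𝓘(ℝ, E) x₁).left_inv hz.2).symm
  have hd : (mfderiv 𝓘(ℝ, E) 𝓘(ℝ, E) (extChartAt 𝓘(ℝ, E) x₀).symm y : E →L[ℝ] E) =
      (mfderiv 𝓘(ℝ, E) 𝓘(ℝ, E) (extChartAt 𝓘(ℝ, E) x₁).symm (T y) : E →L[ℝ] E).comp
        (fderiv ℝ T y) := by
    refine (hev.mfderiv_eq (I := 𝓘(ℝ, E)) (I' := 𝓘(ℝ, E))).trans ?_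
    rw [mfderiv_comp y (mdifferentiableAt_extChartAt_symm' x₁ hTy)
      (hTd.differentiableAt (by simp)).mdifferentiableAt, mfderiv_eq_fderiv]
    rfl
  let φ' : M → (E [⋀^Fin a]→L[ℝ] ℝ) := φ
  ext v
  change φ' ((extChartAt 𝓘(ℝ, E) x₀).symm y) (fun i =>
      (mfderiv 𝓘(ℝ, E) 𝓘(ℝ, E) (extChartAt 𝓘(ℝ, E) x₀).symm y : E →L[ℝ] E) (v i)) =
    φ' ((extChartAt 𝓘(ℝ, E) x₁).symm (T y)) (fun i =>
      (mfderiv 𝓘(ℝ, E) 𝓘(ℝ, E) (extChartAt 𝓘(ℝ, E) x₁).symm (T y) : E →L[ℝ] E)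
        (fderiv ℝ T y (v i)))
  rw [hp, hd]
  rfl

/-- The chart expression of `dφ` is the exterior derivative of the chart expression of `φ`. -/
theorem chartRep_extD {a : ℕ} {φ : DForm E M a} {U : Set M} (hU : IsOpen U)
    (hφ : SmoothFormOn φ U) (x₀ : M) {y : E} (hy : y ∈ (extChartAt 𝓘(ℝ, E) x₀).target)
    (hyU : (extChartAt 𝓘(ℝ, E) x₀).symm y ∈ U) :
    chartRep (extD φ) x₀ y = extDeriv (chartRep φ x₀) y := by
  -- `extD` at a point uses the chart around that very point, so the chart at x₀ is compared with
  -- the one at x₁; d commutes with pullback along the coordinate change T.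
  set x₁ := (extChartAt 𝓘(ℝ, E) x₀).symm y with hx₁
  set T := extChartAt 𝓘(ℝ, E) x₁ ∘ (extChartAt 𝓘(ℝ, E) x₀).symm with hT
  have hy₁ : (extChartAt 𝓘(ℝ, E) x₀).symm y ∈ (extChartAt 𝓘(ℝ, E) x₁).source :=
    mem_extChartAt_source x₁
  have hTd : ContDiffAt ℝ ∞ T y := contDiffAt_coordChange x₀ x₁ hy hy₁
  have hTy : T y ∈ (extChartAt 𝓘(ℝ, E) x₁).target := (extChartAt 𝓘(ℝ, E) x₁).map_source hy₁
  have hev : chartRep φ x₀ =ᶠ[nhds y]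
      fun z => (chartRep φ x₁ (T z)).compContinuousLinearMap (fderiv ℝ T z) := by
    filter_upwards [(isOpen_target_inter_preimage x₀ (isOpen_extChartAt_source
      (I := 𝓘(ℝ, E)) x₁)).mem_nhds ⟨hy, hy₁⟩] with z hz
    exact chartRep_eq_pullback φ x₀ x₁ hz.1 hz.2
  have hdφ : DifferentiableAt ℝ (chartRep φ x₁) (T y) := by
    refine (hφ.contDiffAt hU hTy ?_).differentiableAt (by simp)
    rw [show (extChartAt 𝓘(ℝ, E) x₁).symm (T y) = x₁ from extChartAt_to_inv x₁]
    exact hyU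
  rw [hev.extDeriv_eq, extDeriv_pullback hdφ hTd (by
    rw [minSmoothness_of_isRCLikeNormedField]; exact WithTop.coe_le_coe.2 le_top)]
  have hd : fderiv ℝ T y = (mfderiv 𝓘(ℝ, E) 𝓘(ℝ, E) (extChartAt 𝓘(ℝ, E) x₁) x₁ : E →L[ℝ] E).comp
      (mfderiv 𝓘(ℝ, E) 𝓘(ℝ, E) (extChartAt 𝓘(ℝ, E) x₀).symm y : E →L[ℝ] E) := by
    rw [← mfderiv_eq_fderiv, hT]
    exact mfderiv_comp y
      (mdifferentiableAt_extChartAt (mem_chart_source E x₁))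
      (mdifferentiableAt_extChartAt_symm' x₀ hy)
  rw [hd]
  rfl

/-- In each chart d is a continuous linear alternatization applied to the derivative of the chart
expression. -/
theorem SmoothFormOn.extD {a : ℕ} {φ : DForm E M a} {U : Set M} (hU : IsOpen U)
    (hφ : SmoothFormOn φ U) : SmoothFormOn (extD φ) U := by
  intro x₀
  have h : ContDiffOn ℝ ∞ (extDeriv (chartRep φ x₀))
      ((extChartAt 𝓘(ℝ, E) x₀).target ∩ (extChartAt 𝓘(ℝ, E) x₀).symm ⁻¹' U) := by
    have h' := (hφ x₀).fderiv_of_isOpen (m := ∞) (isOpen_target_inter_preimage x₀ hU) (by simp)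
    exact (ContinuousAlternatingMap.alternatizeUncurryFinCLM ℝ E ℝ).contDiff.comp_contDiffOn h'
  exact h.congr fun y hy => chartRep_extD hU hφ x₀ hy.1 hy.2

end ExteriorDerivative

/-! ### Smooth coefficients in a local frame of forms -/

section SmoothCoefficients

variable {E : Type*} [NormedAddCommGroup E] [NormedSpace ℝ E]
  {M : Type*} [TopologicalSpace M] [ChartedSpace E M]

theorem isOpen_inter_isInvertible {G : Type*} [NormedAddCommGroup G] [NormedSpace ℝ G]
    [CompleteSpace G] {A : M → G →L[ℝ] G} {U : Set M} (hU : IsOpen U) (hA : ContinuousOn A U) :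
    IsOpen (U ∩ {x | (A x).IsInvertible}) :=
  hA.isOpen_inter_preimage hU (ContinuousLinearEquiv.isOpen (𝕜 := ℝ) (E := G) (F := G))

theorem contMDiffOn_inverse {G : Type*} [NormedAddCommGroup G] [NormedSpace ℝ G]
    [CompleteSpace G] {A : M → G →L[ℝ] G} {U : Set M}
    (hA : ContMDiffOn 𝓘(ℝ, E) 𝓘(ℝ, G →L[ℝ] G) ∞ A U) :
    ContMDiffOn 𝓘(ℝ, E) 𝓘(ℝ, G →L[ℝ] G) ∞ (fun x => (A x).inverse)
      (U ∩ {x | (A x).IsInvertible}) := by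
  rintro x ⟨hx, e, he⟩
  have h : ContDiffAt ℝ ∞ ContinuousLinearMap.inverse (A x) := he ▸ contDiffAt_map_inverse e
  exact h.contMDiffAt.comp_contMDiffWithinAt x ((hA x hx).mono inter_subset_left)

variable [IsManifold 𝓘(ℝ, E) ∞ M]

/-- At a fixed point, passing to the chart is pullback along an invertible derivative. Linear
relations and independence can thus be studied in one fixed vector space of forms. -/
theorem chartRep_eq_injective_apply (x₀ : M) {x : M} (hx : x ∈ (chartAt E x₀).source) (a : ℕ) :
    ∃ ℒ : FormAt E x a →ₗ[ℝ] E [⋀^Fin a]→L[ℝ] ℝ, Function.Injective ℒ ∧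
      ∀ φ : DForm E M a, chartRep φ x₀ (extChartAt 𝓘(ℝ, E) x₀ x) = ℒ (φ x) := by
  rw [← extChartAt_source 𝓘(ℝ, E)] at hx
  obtain ⟨y, hy, rfl⟩ : ∃ y ∈ (extChartAt 𝓘(ℝ, E) x₀).target,
      (extChartAt 𝓘(ℝ, E) x₀).symm y = x :=
    ⟨_, (extChartAt 𝓘(ℝ, E) x₀).map_source hx, (extChartAt 𝓘(ℝ, E) x₀).left_inv hx⟩
  rw [(extChartAt 𝓘(ℝ, E) x₀).right_inv hy]
  let p := (extChartAt 𝓘(ℝ, E) x₀).symm y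
  let J : E →L[ℝ] Tan E p := (mfderiv 𝓘(ℝ, E) 𝓘(ℝ, E) (extChartAt 𝓘(ℝ, E) x₀).symm y).comp
    (NormedSpace.fromTangentSpace (𝕜 := ℝ) y).symm.toContinuousLinearMap
  have hJ : Function.Surjective J := by
    have : IsManifold 𝓘(ℝ, E) 1 M := IsManifold.of_le (n := ∞) (by simp)
    have h := (isInvertible_mfderivWithin_extChartAt_symm (I := 𝓘(ℝ, E)) hy).surjective
    rw [ModelWithCorners.range_eq_univ, mfderivWithin_univ] at h
    exact h.comp (NormedSpace.fromTangentSpace (𝕜 := ℝ) y).symm.surjective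
  let ℒ : FormAt E p a →ₗ[ℝ] E [⋀^Fin a]→L[ℝ] ℝ :=
    { toFun := fun β => β.compContinuousLinearMap J
      map_add' := fun _ _ => rfl
      map_smul' := fun _ _ => rfl }
  refine ⟨ℒ, ?_, fun φ => rfl⟩
  intro β₁ β₂ h
  ext v
  choose w hw using fun i => hJ (v i)
  have h' := congrArg (fun β => β w) h
  change β₁ (fun i => J (w i)) = β₂ (fun i => J (w i)) at h'
  simpa only [hw] using h'

theorem SmoothFormOn.contMDiffOn_chartRep {a : ℕ} {φ : DForm E M a} {U : Set M}
    (hφ : SmoothFormOn φ U) (x₀ : M) :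
    ContMDiffOn 𝓘(ℝ, E) 𝓘(ℝ, E [⋀^Fin a]→L[ℝ] ℝ) ∞
      (fun x => chartRep φ x₀ (extChartAt 𝓘(ℝ, E) x₀ x)) ((chartAt E x₀).source ∩ U) := by
  refine (hφ x₀).contMDiffOn.comp (contMDiffOn_extChartAt.mono inter_subset_left) ?_
  rintro x ⟨hx, hxU⟩
  rw [← extChartAt_source 𝓘(ℝ, E)] at hx
  refine ⟨(extChartAt 𝓘(ℝ, E) x₀).map_source hx, ?_⟩
  rwa [mem_preimage, (extChartAt 𝓘(ℝ, E) x₀).left_inv hx]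

variable [FiniteDimensional ℝ E]

theorem finiteDimensional_continuousAlternatingMap (a : ℕ) :
    FiniteDimensional ℝ (E [⋀^Fin a]→L[ℝ] ℝ) :=
  FiniteDimensional.of_injective
    ({ toFun := fun β => β.toMultilinearMap
       map_add' := fun _ _ => rfl
       map_smul' := fun _ _ => rfl } :
      (E [⋀^Fin a]→L[ℝ] ℝ) →ₗ[ℝ] MultilinearMap ℝ (fun _ : Fin a => E) ℝ)
    fun _ _ h => ContinuousAlternatingMap.ext fun v => congrArg (fun f => f v) h

/-- A smooth section `B` of a bundle of forms of rank `r` has smooth components with respect to any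
`r` smooth sections that are linearly independent at a point. -/
theorem exists_smooth_coefficients {a r : ℕ} {U : Set M} (hU : IsOpen U) {x₀ : M} (hx₀ : x₀ ∈ U)
    {B : DForm E M a} (hB : SmoothFormOn B U) {b : Fin r → DForm E M a}
    (hb : ∀ j, SmoothFormOn (b j) U) (hli : LinearIndependent ℝ fun j => b j x₀)
    {W : ∀ x : M, Submodule ℝ (FormAt E x a)} (hW : ∀ x ∈ U, Module.finrank ℝ (W x) = r)
    (hbW : ∀ x ∈ U, ∀ j, b j x ∈ W x) (hBW : ∀ x ∈ U, B x ∈ W x) :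
    ∃ (V : Set M) (c : Fin r → M → ℝ), IsOpen V ∧ x₀ ∈ V ∧ V ⊆ U ∧
      (∀ j, ContMDiffOn 𝓘(ℝ, E) 𝓘(ℝ, ℝ) ∞ (c j) V) ∧ ∀ x ∈ V, B x = ∑ j, c j x • b j x := by
  have hfd : FiniteDimensional ℝ (E [⋀^Fin a]→L[ℝ] ℝ) :=
    finiteDimensional_continuousAlternatingMap a
  let R : DForm E M a → M → E [⋀^Fin a]→L[ℝ] ℝ :=
    fun φ x => chartRep φ x₀ (extChartAt 𝓘(ℝ, E) x₀ x)
  -- a left inverse of the frame at `x₀`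
  obtain ⟨ℒ₀, hinj₀, hℒ₀⟩ := chartRep_eq_injective_apply x₀ (mem_chart_source E x₀) a
  have hli₀ : LinearIndependent ℝ fun j => R (b j) x₀ := by
    have h := hli.map' ℒ₀ (LinearMap.ker_eq_bot.2 hinj₀)
    have e : (fun j => R (b j) x₀) = ℒ₀ ∘ fun j => b j x₀ := funext fun j => hℒ₀ (b j)
    rwa [e]
  obtain ⟨g, hg⟩ := LinearMap.exists_leftInverse_of_injective
    (Fintype.linearCombination ℝ fun j => R (b j) x₀)
    (LinearMap.ker_eq_bot.2 (linearIndependent_iff_injective_fintypeLinearCombination.1 hli₀))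
  let ℓ : (E [⋀^Fin a]→L[ℝ] ℝ) →L[ℝ] (Fin r → ℝ) := g.toContinuousLinearMap
  -- A(x) is the frame at x followed by ℓ, a left inverse of the frame at x₀. It is the identity at
  -- x₀, hence invertible nearby, and the coefficients of B are A(x)⁻¹ ℓ(B).
  let A : M → (Fin r → ℝ) →L[ℝ] (Fin r → ℝ) := fun x =>
    ∑ j, (ContinuousLinearMap.proj (R := ℝ) (φ := fun _ : Fin r => ℝ) j).smulRight (ℓ (R (b j) x))
  have hA_apply : ∀ x c, A x c = ℓ (∑ j, c j • R (b j) x) := by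
    intro x c
    simp [A, map_sum]
  have hAx₀ : A x₀ = ContinuousLinearMap.id ℝ _ := by
    ext1 c
    rw [hA_apply]
    exact LinearMap.congr_fun hg c
  set O := (chartAt E x₀).source ∩ U with hO
  have hOo : IsOpen O := (chartAt E x₀).open_source.inter hU
  have hA : ContMDiffOn 𝓘(ℝ, E) 𝓘(ℝ, (Fin r → ℝ) →L[ℝ] (Fin r → ℝ)) ∞ A O := by
    refine contMDiffOn_finsetSum fun j _ => ?_
    exact ((ContinuousLinearMap.smulRightL ℝ (Fin r → ℝ) (Fin r → ℝ)
      (ContinuousLinearMap.proj j)).comp ℓ).contMDiff.comp_contMDiffOn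
        ((hb j).contMDiffOn_chartRep x₀)
  refine ⟨O ∩ {x | (A x).IsInvertible}, fun j x => (A x).inverse (ℓ (R B x)) j,
    isOpen_inter_isInvertible hOo hA.continuousOn, ⟨⟨mem_chart_source E x₀, hx₀⟩, ?_⟩,
    fun x hx => hx.1.2, ?_, ?_⟩
  · exact ⟨ContinuousLinearEquiv.refl ℝ _, hAx₀.symm⟩
  · intro j
    have h := (contMDiffOn_inverse hA).clm_apply ((ℓ.contMDiff.comp_contMDiffOn
      (hB.contMDiffOn_chartRep x₀)).mono inter_subset_left)
    exact (ContinuousLinearMap.proj (R := ℝ) (φ := fun _ : Fin r => ℝ) j).contMDiff.comp_contMDiffOn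
      h
  · rintro x ⟨⟨hx, hxU⟩, hinv⟩
    obtain ⟨ℒ, -, hℒ⟩ := chartRep_eq_injective_apply x₀ hx a
    -- Injectivity of A(x) forces the b j to stay independent at x; by the rank hypothesis they then
    -- span W x.
    have hlix : LinearIndependent ℝ fun j => b j x := by
      have h : LinearIndependent ℝ fun j => R (b j) x := by
        refine LinearIndependent.of_comp (ℓ : (E [⋀^Fin a]→L[ℝ] ℝ) →ₗ[ℝ] (Fin r → ℝ)) ?_
        rw [linearIndependent_iff_injective_fintypeLinearCombination]
        have e : ⇑(Fintype.linearCombination ℝ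
            (⇑(ℓ : (E [⋀^Fin a]→L[ℝ] ℝ) →ₗ[ℝ] (Fin r → ℝ)) ∘ fun j => R (b j) x)) = A x := by
          funext c
          rw [hA_apply]
          simp [Fintype.linearCombination_apply, map_sum]
        rw [e]
        exact hinv.injective
      refine LinearIndependent.of_comp ℒ ?_
      have e : (ℒ ∘ fun j => b j x) = fun j => R (b j) x := funext fun j => (hℒ (b j)).symm
      rwa [e]
    have hfdx : FiniteDimensional ℝ (FormAt E x a) := hfd
    have hspan : Submodule.span ℝ (range fun j => b j x) = W x := by
      refine Submodule.eq_of_le_of_finrank_eq (Submodule.span_le.2 ?_) ?_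
      · rintro _ ⟨j, rfl⟩
        exact hbW x hxU j
      · rw [finrank_span_eq_card hlix, hW x hxU, Fintype.card_fin]
    have hBx := hBW x hxU
    rw [← hspan, Submodule.mem_span_range_iff_exists_fun] at hBx
    obtain ⟨d, hd⟩ := hBx
    have hc : (A x).inverse (ℓ (R B x)) = d := by
      have e : R B x = ∑ j, d j • R (b j) x := by
        change chartRep B x₀ _ = _
        rw [hℒ, ← hd, map_sum]
        refine Finset.sum_congr rfl fun j _ => ?_
        rw [map_smul]
        exact congrArg _ (hℒ (b j)).symm
      rw [e, ← hA_apply, hinv.inverse_apply_self]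
    simp only [hc, hd]

end SmoothCoefficients

/-! ### Smooth vector fields, sections modulo K, and gluing -/

section Fields

variable {E : Type*} [NormedAddCommGroup E] [NormedSpace ℝ E]
  {M : Type*} [TopologicalSpace M] [ChartedSpace E M] [IsManifold 𝓘(ℝ, E) ∞ M]

theorem SmoothFieldOn.mono {Y : ∀ x : M, Tan E x} {U V : Set M} (h : SmoothFieldOn Y U)
    (hVU : V ⊆ U) : SmoothFieldOn Y V :=
  ContMDiffOn.mono h hVU

theorem SmoothFieldOn.smul {Y : ∀ x : M, Tan E x} {U : Set M} (h : SmoothFieldOn Y U)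
    {f : M → ℝ} (hf : ContMDiffOn 𝓘(ℝ, E) 𝓘(ℝ, ℝ) ∞ f U) :
    SmoothFieldOn (fun x => f x • Y x) U :=
  ContMDiffOn.smul_section hf h

theorem SmoothFieldOn.sum {ι : Type*} {s : Finset ι} {Y : ι → ∀ x : M, Tan E x} {U : Set M}
    (h : ∀ i ∈ s, SmoothFieldOn (Y i) U) : SmoothFieldOn (fun x => ∑ i ∈ s, Y i x) U :=
  ContMDiffOn.sum_section h

theorem SmoothFieldOn.add {Y Z : ∀ x : M, Tan E x} {U : Set M} (hY : SmoothFieldOn Y U)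
    (hZ : SmoothFieldOn Z U) : SmoothFieldOn (fun x => Y x + Z x) U :=
  ContMDiffOn.add_section hY hZ

theorem SmoothFieldOn.sub {Y Z : ∀ x : M, Tan E x} {U : Set M} (hY : SmoothFieldOn Y U)
    (hZ : SmoothFieldOn Z U) : SmoothFieldOn (fun x => Y x - Z x) U :=
  ContMDiffOn.sub_section hY hZ

/-- Every tangent vector extends to a vector field that is smooth near its base point. -/
theorem exists_smoothFieldOn_eq (x₀ : M) (w : Tan E x₀) :
    ∃ (V : Set M) (Y : ∀ x : M, Tan E x), IsOpen V ∧ x₀ ∈ V ∧ SmoothFieldOn Y V ∧ Y x₀ = w := by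
  let e := trivializationAt E (TangentSpace 𝓘(ℝ, E) : M → Type _) x₀
  refine ⟨e.baseSet, fun x => e.symm x (e ⟨x₀, w⟩).2, e.open_baseSet,
    FiberBundle.mem_baseSet_trivializationAt' x₀, ?_, ?_⟩
  · refine (e.contMDiffOn_section_baseSet_iff (IB := 𝓘(ℝ, E)) (n := ∞)).2 ?_
    refine (contMDiffOn_const (c := (e ⟨x₀, w⟩).2)).congr fun x hx => ?_
    rw [e.apply_mk_symm hx]
  · exact e.symm_apply_apply_mk (FiberBundle.mem_baseSet_trivializationAt' x₀) w

variable {K : ∀ x : M, Submodule ℝ (Tan E x)}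

theorem SmoothFieldOn.smoothModOn {Y : ∀ x : M, Tan E x} {U : Set M} (hU : IsOpen U)
    (h : SmoothFieldOn Y U) : SmoothModOn K (fun x => (K x).mkQ (Y x)) U :=
  fun _ hx => ⟨U, hU, hx, Y, h, fun _ _ => rfl⟩

theorem SmoothModOn.sub {s t : ∀ x : M, Tan E x ⧸ K x} {U : Set M} (hs : SmoothModOn K s U)
    (ht : SmoothModOn K t U) : SmoothModOn K (fun x => s x - t x) U := by
  intro x₀ hx₀
  obtain ⟨V, hV, hxV, Y, hY, hYs⟩ := hs x₀ hx₀
  obtain ⟨W, hW, hxW, Z, hZ, hZt⟩ := ht x₀ hx₀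
  refine ⟨V ∩ W, hV.inter hW, ⟨hxV, hxW⟩, fun x => Y x - Z x,
    (hY.mono inter_subset_left).sub (hZ.mono inter_subset_right), fun x hx => ?_⟩
  rw [map_sub, hYs x hx.1, hZt x hx.2]

theorem SmoothModOn.add {s t : ∀ x : M, Tan E x ⧸ K x} {U : Set M} (hs : SmoothModOn K s U)
    (ht : SmoothModOn K t U) : SmoothModOn K (fun x => s x + t x) U := by
  intro x₀ hx₀
  obtain ⟨V, hV, hxV, Y, hY, hYs⟩ := hs x₀ hx₀
  obtain ⟨W, hW, hxW, Z, hZ, hZt⟩ := ht x₀ hx₀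
  refine ⟨V ∩ W, hV.inter hW, ⟨hxV, hxW⟩, fun x => Y x + Z x,
    (hY.mono inter_subset_left).add (hZ.mono inter_subset_right), fun x hx => ?_⟩
  rw [map_add, hYs x hx.1, hZt x hx.2]

theorem SmoothModOn.smul {s : ∀ x : M, Tan E x ⧸ K x} {U : Set M} (hs : SmoothModOn K s U)
    {f : M → ℝ} (hf : ContMDiffOn 𝓘(ℝ, E) 𝓘(ℝ, ℝ) ∞ f U) (hU : IsOpen U) :
    SmoothModOn K (fun x => f x • s x) U := by
  intro x₀ hx₀
  obtain ⟨V, hV, hxV, Y, hY, hYs⟩ := hs x₀ hx₀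
  refine ⟨V ∩ U, hV.inter hU, ⟨hxV, hx₀⟩, fun x => f x • Y x,
    (hY.mono inter_subset_left).smul (hf.mono inter_subset_right), fun x hx => ?_⟩
  rw [map_smul, hYs x hx.1]

theorem SmoothModOn.zero {U : Set M} (hU : IsOpen U) :
    SmoothModOn K (fun x => (0 : Tan E x ⧸ K x)) U := by
  have h : SmoothFieldOn (fun x : M => (0 : Tan E x)) U := by
    simpa using SmoothFieldOn.sum (s := (∅ : Finset ℕ)) (Y := fun _ x => (0 : Tan E x)) (U := U)
      (by simp)
  exact fun x hx => ⟨U, hU, hx, _, h, fun _ _ => map_zero _⟩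

theorem SmoothModOn.sum {ι : Type*} {I : Finset ι} {s : ι → ∀ x : M, Tan E x ⧸ K x} {U : Set M}
    (hU : IsOpen U) (hs : ∀ i ∈ I, SmoothModOn K (s i) U) :
    SmoothModOn K (fun x => ∑ i ∈ I, s i x) U := by
  classical
  induction I using Finset.induction_on with
  | empty => simpa using SmoothModOn.zero hU
  | insert i I hi ih =>
    simp only [Finset.sum_insert hi]
    exact (hs i (Finset.mem_insert_self _ _)).add
      (ih fun j hj => hs j (Finset.mem_insert_of_mem hj))

/-- A smooth section modulo `K` only has to be known locally. -/
theorem SmoothModOn.of_locally {s : ∀ x : M, Tan E x ⧸ K x} {U : Set M}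
    (h : ∀ x₀ ∈ U, ∃ V : Set M, IsOpen V ∧ x₀ ∈ V ∧ ∃ t : ∀ x : M, Tan E x ⧸ K x,
      SmoothModOn K t V ∧ ∀ x ∈ V, s x = t x) : SmoothModOn K s U := by
  intro x₀ hx₀
  obtain ⟨V, hV, hxV, t, ht, hst⟩ := h x₀ hx₀
  obtain ⟨W, hW, hxW, Y, hY, hYt⟩ := ht x₀ hxV
  exact ⟨W ∩ V, hW.inter hV, ⟨hxW, hxV⟩, Y, hY.mono inter_subset_left,
    fun x hx => (hYt x hx.1).trans (hst x hx.2).symm⟩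

/-- Families of endomorphisms of the tangent spaces that preserve smoothness of vector fields on
open subsets of `U`. -/
def PreservesSmoothFieldsOn (P : ∀ x : M, Tan E x →ₗ[ℝ] Tan E x) (U : Set M) : Prop :=
  ∀ V ⊆ U, IsOpen V → ∀ Y : ∀ x : M, Tan E x, SmoothFieldOn Y V →
    SmoothFieldOn (fun x => P x (Y x)) V

/-- Local endomorphisms of the tangent bundle subject to convex conditions can be glued. -/
theorem exists_endomorphism_forall_mem_convex_of_local [FiniteDimensional ℝ E]
    [SigmaCompactSpace M] [T2Space M] {t : ∀ x : M, Set (Tan E x →ₗ[ℝ] Tan E x)}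
    (ht : ∀ x, Convex ℝ (t x))
    (hloc : ∀ x₀ : M, ∃ (U : Set M) (P : ∀ x : M, Tan E x →ₗ[ℝ] Tan E x), IsOpen U ∧ x₀ ∈ U ∧
      PreservesSmoothFieldsOn P U ∧ ∀ x ∈ U, P x ∈ t x) :
    ∃ P : ∀ x : M, Tan E x →ₗ[ℝ] Tan E x, PreservesSmoothFieldsOn P univ ∧ ∀ x, P x ∈ t x := by
  choose U P hUo hxU hP hPt using hloc
  obtain ⟨ρ, hρU⟩ := SmoothPartitionOfUnity.exists_isSubordinate 𝓘(ℝ, E) isClosed_univ U hUo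
    (fun x _ => mem_iUnion.2 ⟨x, hxU x⟩)
  refine ⟨fun x => ∑ᶠ j, ρ j x • P j x, ?_, fun x => ?_⟩
  · intro V _ hV Y hY
    have hfin : ∀ x, (Function.support fun j => ρ j x • P j x).Finite := fun x =>
      (ρ.locallyFinite.point_finite x).subset fun j hj h => hj (by
        change ρ j x • P j x = 0
        rw [h, zero_smul])
    have e : (fun x => (∑ᶠ j, ρ j x • P j x) (Y x)) = fun x => ∑ᶠ j, ρ j x • P j x (Y x) := by
      funext x
      exact map_finsum (LinearMap.applyₗ (R := ℝ) (M₂ := Tan E x) (Y x)) (hfin x)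
    rw [e]
    refine ContMDiffOn.finsum_section_of_locallyFinite (ρ.locallyFinite.subset ?_) fun j => ?_
    · intro j x hx h
      exact hx (by rw [h, zero_smul])
    · intro x hx
      -- P j is controlled only on U j. The support of ρ j lies there, and off that support the
      -- summand is zero near x.
      by_cases hxj : x ∈ tsupport (ρ j)
      · have hxUj : x ∈ U j := hρU j hxj
        have h1 : SmoothFieldOn (fun x => ρ j x • P j x (Y x)) (V ∩ U j) :=
          (hP j (V ∩ U j) inter_subset_right (hV.inter (hUo j)) Y
            (hY.mono inter_subset_left)).smul (ρ j).contMDiff.contMDiffOn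
        exact (ContMDiffOn.contMDiffAt h1 ((hV.inter (hUo j)).mem_nhds ⟨hx, hxUj⟩)
          ).contMDiffWithinAt
      · refine ContMDiffAt.contMDiffWithinAt ?_
        refine (Bundle.contMDiff_zeroSection ℝ (TangentSpace 𝓘(ℝ, E) : M → Type _) x
          ).congr_of_eventuallyEq ?_
        filter_upwards [(isClosed_tsupport (ρ j)).isOpen_compl.mem_nhds hxj] with y hy
        have hz : ρ j y = 0 := image_eq_zero_of_notMem_tsupport hy
        simp [hz, Bundle.zeroSection]
  · refine (ht x).finsum_mem (ρ.nonneg · x) (ρ.sum_eq_one (mem_univ x)) fun j hj => ?_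
    exact hPt j x (hρU j (subset_closure hj))

end Fields

/-! ### Existence of connections over a lift modulo K₁ -/

section Connections

variable {E : Type*} [NormedAddCommGroup E] [NormedSpace ℝ E]
  {M : Type*} [TopologicalSpace M] [ChartedSpace E M] [IsManifold 𝓘(ℝ, E) ∞ M]
  {F : Type*} [NormedAddCommGroup F] [NormedSpace ℝ F]
  {X : Type*} [TopologicalSpace X] [ChartedSpace F X]
  {k : ℕ} {D : AlmostGradedDirac E M k} {τ : M → X}

/-- The tangent projections `T_x M → T_x M` along `ker dτ` that represent the horizontal lift
modulo `K₁` given by `g`. -/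
def projectionsOver (g : HorizontalLiftMod D F τ) (x : M) : Set (Tan E x →ₗ[ℝ] Tan E x) :=
  {P | (∀ v, dmap E F τ x v = 0 → P v = 0) ∧
    ∀ v, (K₁ D x).mkQ (P v) = g.lift x (dmap E F τ x v)}

theorem convex_projectionsOver (g : HorizontalLiftMod D F τ) (x : M) :
    Convex ℝ (projectionsOver g x) := by
  rintro P ⟨hP, hP'⟩ Q ⟨hQ, hQ'⟩ a b _ _ hab
  refine ⟨fun v hv => ?_, fun v => ?_⟩
  · simp [hP v hv, hQ v hv]
  · rw [LinearMap.add_apply, LinearMap.smul_apply, LinearMap.smul_apply, map_add, map_smul,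
      map_smul, hP', hQ', ← add_smul, hab, one_smul]

/-- The components of `dτ(Y)` in a trivialization of `TX` are smooth. -/
theorem contMDiffOn_dmap_trivialization [IsManifold 𝓘(ℝ, F) ∞ X]
    (hτ : ContMDiff 𝓘(ℝ, E) 𝓘(ℝ, F) ∞ τ) (z₀ : X)
    {U : Set M} (hU : U ⊆ τ ⁻¹' (trivializationAt F (TangentSpace 𝓘(ℝ, F)) z₀).baseSet)
    {Y : ∀ x : M, Tan E x} (hY : SmoothFieldOn Y U) :
    ContMDiffOn 𝓘(ℝ, E) 𝓘(ℝ, F) ∞ (fun x =>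
      (trivializationAt F (TangentSpace 𝓘(ℝ, F)) z₀).continuousLinearMapAt ℝ (τ x)
        (dmap E F τ x (Y x))) U := by
  have h : ContMDiffOn 𝓘(ℝ, E) 𝓘(ℝ, F).tangent ∞
      (fun x => (⟨τ x, dmap E F τ x (Y x)⟩ : TangentBundle 𝓘(ℝ, F) X)) U :=
    (hτ.contMDiff_tangentMap (m := ∞) (by simp)).comp_contMDiffOn hY
  have h' := ((trivializationAt F (TangentSpace 𝓘(ℝ, F)) z₀).contMDiffOn_iff (IB := 𝓘(ℝ, F))
    (n := ∞) (fun x hx => by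
      rw [Bundle.Trivialization.mem_source]
      exact hU hx)).1 h
  refine h'.2.congr fun x hx => ?_
  rw [Bundle.Trivialization.continuousLinearMapAt_apply,
    Bundle.Trivialization.coe_linearMapAt_of_mem _ (hU hx)]

/-- Take fields Y i whose images dτ(Y i) are a frame of τ*TX near x₀, and fields Z i representing
g(dτ(Y i)). Sending v to the combination of the Z i, with the coefficients of dτ v in this frame, is
the desired projection. -/
theorem exists_local_projectionsOver [FiniteDimensional ℝ F] [IsManifold 𝓘(ℝ, F) ∞ X]
    (hτ : IsFibered D F τ) (g : HorizontalLiftMod D F τ) (x₀ : M) :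
    ∃ (U : Set M) (P : ∀ x : M, Tan E x →ₗ[ℝ] Tan E x), IsOpen U ∧ x₀ ∈ U ∧
      PreservesSmoothFieldsOn P U ∧ ∀ x ∈ U, P x ∈ projectionsOver g x := by
  let e := trivializationAt F (TangentSpace 𝓘(ℝ, F) : X → Type _) (τ x₀)
  let ε : ∀ x : M, Tan F (τ x) →L[ℝ] F := fun x => e.continuousLinearMapAt ℝ (τ x)
  have hx₀e : τ x₀ ∈ e.baseSet := FiberBundle.mem_baseSet_trivializationAt' (τ x₀)
  let b := Module.finBasis ℝ F
  choose w hw using fun i => hτ.submersion x₀ (e.symmL ℝ (τ x₀) (b i))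
  choose V Y hVo hxV hY hYw using fun i => exists_smoothFieldOn_eq x₀ (w i)
  choose W hWo hxW Z hZ hZg using fun i => g.smooth (V i) (hVo i) (Y i) (hY i) x₀ (hxV i)
  let O : Set M := τ ⁻¹' e.baseSet ∩ ⋂ i, (V i ∩ W i)
  have hO : IsOpen O := (e.open_baseSet.preimage hτ.smooth.continuous).inter
    (isOpen_iInter_of_finite fun i => (hVo i).inter (hWo i))
  have hxO : x₀ ∈ O := ⟨hx₀e, mem_iInter.2 fun i => ⟨hxV i, hxW i⟩⟩
  have hOV : ∀ i, O ⊆ V i := fun i x hx => (mem_iInter.1 hx.2 i).1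
  have hOW : ∀ i, O ⊆ W i := fun i x hx => (mem_iInter.1 hx.2 i).2
  -- N(x) sends b i to dτ(Y i) read in the trivialization, so N(x)⁻¹ computes coefficients in the
  -- frame dτ(Y i). The choice of w makes N(x₀) the identity.
  let N : M → F →L[ℝ] F := fun x => ∑ i, (b.coord i).toContinuousLinearMap.smulRight
    (ε x (dmap E F τ x (Y i x)))
  have hN_apply : ∀ x z, N x z = ∑ i, b.repr z i • ε x (dmap E F τ x (Y i x)) := by
    intro x z
    simp [N]
  have hN : ContMDiffOn 𝓘(ℝ, E) 𝓘(ℝ, F →L[ℝ] F) ∞ N O := by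
    refine contMDiffOn_finsetSum fun i _ => ?_
    exact (ContinuousLinearMap.smulRightL ℝ F F
      (b.coord i).toContinuousLinearMap).contMDiff.comp_contMDiffOn
        (contMDiffOn_dmap_trivialization hτ.smooth (τ x₀) inter_subset_left ((hY i).mono (hOV i)))
  have hNx₀ : N x₀ = ContinuousLinearMap.id ℝ F := by
    ext z
    rw [hN_apply]
    have : ∀ i, ε x₀ (dmap E F τ x₀ (Y i x₀)) = b i := fun i => by
      rw [hYw, hw]
      exact e.continuousLinearMapAt_symmL hx₀e (b i)
    simp only [this]
    exact b.sum_repr z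
  have hcs : CompleteSpace F := FiniteDimensional.complete ℝ F
  let U : Set M := O ∩ {x | (N x).IsInvertible}
  let P : ∀ x : M, Tan E x →ₗ[ℝ] Tan E x := fun x =>
    (Fintype.linearCombination ℝ fun i => Z i x) ∘ₗ b.equivFun.toLinearMap ∘ₗ
      ((N x).inverse ∘L ε x ∘L dmap E F τ x : Tan E x →L[ℝ] F).toLinearMap
  have hP_apply : ∀ x v, P x v =
      ∑ i, b.coord i ((N x).inverse (ε x (dmap E F τ x v))) • Z i x := fun x v => by
    simp [P, Fintype.linearCombination_apply]
  refine ⟨U, P, isOpen_inter_isInvertible hO hN.continuousOn,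
    ⟨hxO, ContinuousLinearEquiv.refl ℝ F, hNx₀.symm⟩, ?_, ?_⟩
  · intro A hAU hA y hy
    simp only [hP_apply]
    refine SmoothFieldOn.sum fun i _ => ((hZ i).mono fun x hx => hOW i (hAU hx).1).smul ?_
    refine (b.coord i).toContinuousLinearMap.contMDiff.comp_contMDiffOn ?_
    exact ((contMDiffOn_inverse hN).mono hAU).clm_apply
      (contMDiffOn_dmap_trivialization hτ.smooth (τ x₀) (fun x hx => (hAU hx).1.1) hy)
  · rintro x ⟨hxO, hinv⟩
    refine ⟨fun v hv => ?_, fun v => ?_⟩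
    · rw [hP_apply, hv]
      simp
    · rw [hP_apply, map_sum]
      have h1 : ∀ i, (K₁ D x).mkQ (Z i x) = g.lift x (dmap E F τ x (Y i x)) :=
        fun i => hZg i x (hOW i hxO)
      simp only [map_smul, h1]
      simp only [← map_smul, ← map_sum]
      congr 1
      have hinj : Function.Injective (ε x) := by
        intro u v huv
        have h2 := congrArg (e.symmL ℝ (τ x)) huv
        exact (e.symmL_continuousLinearMapAt hxO.1 u).symm.trans
          (h2.trans (e.symmL_continuousLinearMapAt hxO.1 v))
      apply hinj
      have h2 := hinv.self_apply_inverse (ε x (dmap E F τ x v))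
      rw [hN_apply] at h2
      simpa using h2

/-- The local projections over g form convex sets, so they glue to a global one, which descends
along dτ. Without such a connection, condition 2 on γ would carry no information. -/
theorem exists_horizontalLift_coincidesWith [FiniteDimensional ℝ E] [SigmaCompactSpace M]
    [T2Space M] [FiniteDimensional ℝ F] [IsManifold 𝓘(ℝ, F) ∞ X] (hτ : IsFibered D F τ) (g : HorizontalLiftMod D F τ) :
    ∃ h : HorizontalLift E F τ, h.CoincidesWith g := by
  obtain ⟨P, hP, hPg⟩ := exists_endomorphism_forall_mem_convex_of_local
    (convex_projectionsOver g) (exists_local_projectionsOver hτ g)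
  have hfd : ∀ z : X, FiniteDimensional ℝ (Tan F z) := fun z => inferInstanceAs
    (FiniteDimensional ℝ F)
  have ht2 : ∀ z : X, T2Space (Tan F z) := fun z => inferInstanceAs (T2Space F)
  have hR : ∀ x : M, ∃ R : Tan F (τ x) →ₗ[ℝ] Tan E x,
      (dmap E F τ x : Tan E x →ₗ[ℝ] Tan F (τ x)) ∘ₗ R = LinearMap.id := fun x =>
    LinearMap.exists_rightInverse_of_surjective _ (LinearMap.range_eq_top.2 (hτ.submersion x))
  choose R hR using hR
  have hR' : ∀ x z, dmap E F τ x (R x z) = z := fun x z => LinearMap.congr_fun (hR x) z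
  have hQ : ∀ x z, (K₁ D x).mkQ (P x (R x z)) = g.lift x z := fun x z => by
    rw [(hPg x).2, hR']
  let lift : ∀ x : M, Tan F (τ x) →L[ℝ] Tan E x := fun x =>
    (P x ∘ₗ R x : Tan F (τ x) →ₗ[ℝ] Tan E x).toContinuousLinearMap
  refine ⟨⟨lift, fun x z => g.dmap_lift x z _ (hQ x z), fun U hU Y hY => ?_⟩, hQ⟩
  -- The right inverses R x are chosen with no smoothness in x. As P kills vertical vectors, P R dτ
  -- = P, so R disappears.
  have e : (fun x => lift x (dmap E F τ x (Y x))) = fun x => P x (Y x) := by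
    funext x
    change P x (R x (dmap E F τ x (Y x))) = P x (Y x)
    rw [← sub_eq_zero, ← map_sub]
    exact (hPg x).1 _ (by rw [map_sub, hR', sub_self])
  rw [e]
  exact hP U (subset_univ U) hU Y hY

end Connections

/-- Two-point affinity implies affinity for arbitrary finite affine combinations. -/
theorem exists_affine_sum {V W ι : Type*} [AddCommGroup V] [Module ℝ V] [AddCommGroup W]
    [Module ℝ W] {G : Set V} (hG : ∀ a ∈ G, ∀ b ∈ G, ∀ t : ℝ, t • a + (1 - t) • b ∈ G)
    {f : G → W} (hf : ∀ (a b c : G) (t : ℝ), c.1 = t • a.1 + (1 - t) • b.1 →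
      f c = t • f a + (1 - t) • f b)
    (b₀ : G) (b : ι → G) (c : ι → ℝ) (I : Finset ι) :
    ∃ h : b₀.1 + ∑ i ∈ I, c i • ((b i).1 - b₀.1) ∈ G,
      f ⟨_, h⟩ = f b₀ + ∑ i ∈ I, c i • (f (b i) - f b₀) := by
  classical
  induction I using Finset.induction_on with
  | empty =>
    have e : b₀.1 + ∑ i ∈ (∅ : Finset ι), c i • ((b i).1 - b₀.1) = b₀.1 := by simp
    refine ⟨e.symm ▸ b₀.2, ?_⟩
    exact (congrArg f (Subtype.ext e)).trans (by simp)
  | insert i I hi ih =>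
    obtain ⟨h, hfh⟩ := ih
    set β : G := ⟨_, h⟩ with hβ
    -- Only two-point combinations are available, so β + c i (b i - b₀) is written as the midpoint
    -- of p = 2β - b₀ and q = b₀ + 2 c i (b i - b₀).
    let p : G := ⟨(2 : ℝ) • β.1 + (1 - (2 : ℝ)) • b₀.1, hG _ β.2 _ b₀.2 2⟩
    let q : G := ⟨(2 * c i) • (b i).1 + (1 - 2 * c i) • b₀.1, hG _ (b i).2 _ b₀.2 _⟩
    have e : b₀.1 + ∑ j ∈ insert i I, c j • ((b j).1 - b₀.1) =
        (1 / 2 : ℝ) • p.1 + (1 - 1 / 2 : ℝ) • q.1 := by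
      rw [Finset.sum_insert hi]
      simp only [p, q, hβ]
      module
    refine ⟨e.symm ▸ hG _ p.2 _ q.2 _, ?_⟩
    rw [hf p q _ (1 / 2) e, hf β b₀ p 2 rfl, hf (b i) b₀ q _ rfl, hfh, Finset.sum_insert hi]
    module

/-! ### Affine structure of Γ and the two directions of the correspondence -/

section Correspondence

variable {E : Type*} [NormedAddCommGroup E] [NormedSpace ℝ E]
  {M : Type*} [TopologicalSpace M] [ChartedSpace E M] [IsManifold 𝓘(ℝ, E) ∞ M]
  {F : Type*} [NormedAddCommGroup F] [NormedSpace ℝ F]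
  {X : Type*} [TopologicalSpace X] [ChartedSpace F X]
  {k : ℕ} {D : AlmostGradedDirac E M k} {τ : M → X}

theorem SExt_combination {x : M} {β₁ β₂ : FormAt E x (k + 1 + 1)} (h₁ : β₁ ∈ SExt D x)
    (h₂ : β₂ ∈ SExt D x) (s t : ℝ) : s • β₁ + t • β₂ ∈ SExt D x := by
  obtain ⟨hw₁, L₁, hL₁⟩ := h₁
  obtain ⟨hw₂, L₂, hL₂⟩ := h₂
  refine ⟨Submodule.add_mem _ (Submodule.smul_mem _ _ hw₁) (Submodule.smul_mem _ _ hw₂),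
    s • L₁ + t • L₂, fun α v => ?_⟩
  rw [contrMod_combination L₁ L₂ s t α.2, hL₁ α v, hL₂ α v, sharpOne_combination]
  rfl

/-- ♯̃₁ is linear while 𝟙ₙ is constant, so the coefficients have to sum to 1. -/
theorem Γfib_combination {x : M} {β₁ β₂ : FormAt E x (k + 1 + 1)} (h₁ : β₁ ∈ Γfib D F τ x)
    (h₂ : β₂ ∈ Γfib D F τ x) (t : ℝ) : t • β₁ + (1 - t) • β₂ ∈ Γfib D F τ x := by
  refine ⟨SExt_combination h₁.1 h₂.1 _ _, fun α v hv => ?_⟩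
  have e₁ : - sharpOne D β₁ α v + α.1 v = 0 := h₁.2 α v hv
  have e₂ : - sharpOne D β₂ α v + α.1 v = 0 := h₂.2 α v hv
  change - (t * sharpOne D β₁ α v + (1 - t) * sharpOne D β₂ α v) + α.1 v = 0
  linear_combination t * e₁ + (1 - t) * e₂

theorem IsHamiltonian.extD_combination {H₁ H₂ : DForm E M (k + 1)} (h₁ : IsHamiltonian D F τ H₁)
    (h₂ : IsHamiltonian D F τ H₂) (t : ℝ) (x : M) :
    extD (t • H₁ + (1 - t) • H₂) x = t • extD H₁ x + (1 - t) • extD H₂ x :=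
  GradedDirac.extD_combination isOpen_univ h₁.smooth h₂.smooth _ _ (mem_univ x)

theorem IsHamiltonian.combination {H₁ H₂ : DForm E M (k + 1)} (h₁ : IsHamiltonian D F τ H₁)
    (h₂ : IsHamiltonian D F τ H₂) (t : ℝ) : IsHamiltonian D F τ (t • H₁ + (1 - t) • H₂) where
  smooth := h₁.smooth.combination h₂.smooth _ _
  extD_mem x := by
    rw [h₁.extD_combination h₂]
    exact SExt_combination (h₁.extD_mem x) (h₂.extD_mem x) _ _
  semibasic x := by
    rw [h₁.extD_combination h₂]
    exact (Γfib_combination (h₁.extD_mem_Γfib x) (h₂.extD_mem_Γfib x) t).2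
  identity x φ hφ := by
    rw [h₁.extD_combination h₂, sharpOne_combination]
    ext v
    have e₁ : - sharpOne D (extD H₁ x) φ v + φ.1 v = φ.1 v :=
      congrArg (fun β => β v) (h₁.identity x φ hφ)
    have e₂ : - sharpOne D (extD H₂ x) φ v + φ.1 v = φ.1 v :=
      congrArg (fun β => β v) (h₂.identity x φ hφ)
    change - (t * sharpOne D (extD H₁ x) φ v + (1 - t) * sharpOne D (extD H₂ x) φ v) + φ.1 v
      = φ.1 v
    linear_combination t * e₁ + (1 - t) * e₂

theorem VerticalExtension.ext_toFun {σ σ' : VerticalExtension D F τ}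
    (h : ∀ x β w, σ.toFun x β w = σ'.toFun x β w) : σ = σ' := by
  have h' : σ.toFun = σ'.toFun := by
    funext x β
    exact LinearMap.ext (h x β)
  cases σ
  cases σ'
  simp only at h'
  subst h'
  rfl

theorem HorizontalLiftMod.ext_lift {g g' : HorizontalLiftMod D F τ}
    (h : ∀ x z, g.lift x z = g'.lift x z) : g = g' := by
  have h' : g.lift = g'.lift := by
    funext x
    exact LinearMap.ext (h x)
  cases g
  cases g'
  simp only at h'
  subst h'
  rfl

theorem SolutionMap.ext_lift {γ γ' : SolutionMap D F τ}
    (h : ∀ H x z, (γ.toFun H).lift x z = (γ'.toFun H).lift x z) : γ = γ' := by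
  have h' : γ.toFun = γ'.toFun := by
    funext H
    exact HorizontalLiftMod.ext_lift (h H)
  cases γ
  cases γ'
  simp only at h'
  subst h'
  rfl

/-! ### From extensions to solution maps -/

/-- A linear right inverse of `dτ` at a point. -/
noncomputable def IsFibered.rightInverse (hτ : IsFibered D F τ) (x : M) :
    Tan F (τ x) →ₗ[ℝ] Tan E x :=
  (LinearMap.exists_rightInverse_of_surjective (dmap E F τ x : Tan E x →ₗ[ℝ] Tan F (τ x))
    (LinearMap.range_eq_top.2 (hτ.submersion x))).choose

@[simp] theorem IsFibered.dmap_rightInverse (hτ : IsFibered D F τ) (x : M) (z : Tan F (τ x)) :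
    dmap E F τ x (hτ.rightInverse x z) = z :=
  LinearMap.congr_fun (LinearMap.exists_rightInverse_of_surjective
    (dmap E F τ x : Tan E x →ₗ[ℝ] Tan F (τ x))
    (LinearMap.range_eq_top.2 (hτ.submersion x))).choose_spec z

theorem VerticalExtension.apply_vertical (hτ : IsFibered D F τ) (σ : VerticalExtension D F τ)
    {x : M} (β : Γfib D F τ x) {w : Tan E x} (hw : dmap E F τ x w = 0) :
    σ.toFun x β w = (K₁ D x).mkQ w :=
  hτ.apply_vertical β.2 (σ.vertical x β) (σ.isExtension x β) hw

/-- The linear map `dτ w ↦ w - ♯̃ₙ(β)(w)`. -/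
noncomputable def VerticalExtension.liftAt (hτ : IsFibered D F τ) (σ : VerticalExtension D F τ)
    {x : M} (β : Γfib D F τ x) : Tan F (τ x) →ₗ[ℝ] Tan E x ⧸ K₁ D x :=
  ((K₁ D x).mkQ - σ.toFun x β) ∘ₗ hτ.rightInverse x

/-- The chosen preimage of dτ w differs from w by a vertical vector, on which 1 - ♯̃ₙ(β) vanishes
modulo K₁. -/
theorem VerticalExtension.liftAt_dmap (hτ : IsFibered D F τ) (σ : VerticalExtension D F τ)
    {x : M} (β : Γfib D F τ x) (w : Tan E x) :
    σ.liftAt hτ β (dmap E F τ x w) = (K₁ D x).mkQ w - σ.toFun x β w := by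
  have h := σ.apply_vertical hτ β (w := hτ.rightInverse x (dmap E F τ x w) - w) (by simp)
  rw [map_sub, map_sub, sub_eq_sub_iff_sub_eq_sub] at h
  change (K₁ D x).mkQ _ - σ.toFun x β _ = _
  rw [← neg_sub, h, neg_sub]

/-- The solution map of a vertical valued extension. -/
noncomputable def VerticalExtension.toSolutionMap (hτ : IsFibered D F τ)
    (σ : VerticalExtension D F τ) : SolutionMap D F τ where
  toFun H :=
    { lift := fun x => σ.liftAt hτ ⟨extD H.1 x, H.2.extD_mem_Γfib x⟩
      dmap_lift := by
        intro x z w hw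
        obtain ⟨v, rfl⟩ := hτ.submersion x z
        rw [σ.liftAt_dmap] at hw
        have h := σ.vertical x ⟨extD H.1 x, H.2.extD_mem_Γfib x⟩ v (v - w)
          (by rw [map_sub, hw, sub_sub_cancel])
        rw [map_sub, sub_eq_zero] at h
        exact h.symm
      smooth := by
        intro U hU Y hY
        have e : (fun x => σ.liftAt hτ ⟨extD H.1 x, H.2.extD_mem_Γfib x⟩ (dmap E F τ x (Y x))) =
            fun x => (K₁ D x).mkQ (Y x) -
              σ.toFun x ⟨extD H.1 x, H.2.extD_mem_Γfib x⟩ (Y x) :=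
          funext fun x => σ.liftAt_dmap hτ _ _
        rw [e]
        exact (hY.smoothModOn hU).sub (σ.smooth U hU (extD H.1)
          ((H.2.smooth.extD isOpen_univ).mono (subset_univ U))
          (fun x _ => H.2.extD_mem_Γfib x) Y hY _ fun x _ _ => rfl) }
  affine := by
    intro H₁ H₂ H₃ t h x
    ext z
    obtain ⟨w, rfl⟩ := hτ.submersion x z
    have e : extD H₃.1 x = t • extD H₁.1 x + (1 - t) • extD H₂.1 x := by
      rw [h, H₁.2.extD_combination H₂.2]
    rw [LinearMap.add_apply, LinearMap.smul_apply, LinearMap.smul_apply, σ.liftAt_dmap,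
      σ.liftAt_dmap, σ.liftAt_dmap, σ.affine x ⟨extD H₁.1 x, H₁.2.extD_mem_Γfib x⟩ ⟨extD H₂.1 x, H₂.2.extD_mem_Γfib x⟩
      ⟨extD H₃.1 x, H₃.2.extD_mem_Γfib x⟩ t e, LinearMap.add_apply, LinearMap.smul_apply,
      LinearMap.smul_apply]
    module
  pointwise := by
    intro H₁ H₂ x h
    exact congrArg (σ.liftAt hτ) (Subtype.ext h)
  solves := by
    intro H h hco U hU α hα x hx hxS
    ext v
    let β : Γfib D F τ x := ⟨extD H.1 x, H.2.extD_mem_Γfib x⟩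
    have e := hτ.apply_sub_vertical (σ.vertical x β) hxS (fun w => h.lift x (dmap E F τ x w))
      (fun w => by rw [hco, ← σ.liftAt_dmap hτ]) v
    rw [σ.isExtension x β ⟨_, hxS⟩ v] at e
    exact e

/-! ### From solution maps to extensions -/

variable (hfill : ∀ (x : M), ∀ β ∈ Γfib D F τ x,
  ∃ H : DForm E M (k + 1), IsHamiltonian D F τ H ∧ extD H x = β)

/-- The map `w ↦ w - γ_H(dτ w)`, for any Hamiltonian `H` with `dH = β` at `x`. -/
noncomputable def SolutionMap.extensionAt (γ : SolutionMap D F τ) (x : M) (β : Γfib D F τ x) :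
    Tan E x →ₗ[ℝ] Tan E x ⧸ K₁ D x :=
  (K₁ D x).mkQ - (γ.toFun ⟨(hfill x β.1 β.2).choose, (hfill x β.1 β.2).choose_spec.1⟩).lift x ∘ₗ
    (dmap E F τ x : Tan E x →ₗ[ℝ] Tan F (τ x))

/-- Condition 1 makes the choice of Hamiltonian irrelevant. -/
theorem SolutionMap.extensionAt_apply (γ : SolutionMap D F τ) {x : M} (β : Γfib D F τ x)
    (H : {H : DForm E M (k + 1) // IsHamiltonian D F τ H}) (hH : extD H.1 x = β.1) (w : Tan E x) :
    γ.extensionAt hfill x β w = (K₁ D x).mkQ w - (γ.toFun H).lift x (dmap E F τ x w) := by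
  rw [γ.pointwise H ⟨(hfill x β.1 β.2).choose, (hfill x β.1 β.2).choose_spec.1⟩ x
    (hH.trans (hfill x β.1 β.2).choose_spec.2.symm)]
  rfl

theorem SolutionMap.extensionAt_affine (γ : SolutionMap D F τ) (x : M) (β₁ β₂ β₃ : Γfib D F τ x)
    (t : ℝ) (h : β₃.1 = t • β₁.1 + (1 - t) • β₂.1) :
    γ.extensionAt hfill x β₃ =
      t • γ.extensionAt hfill x β₁ + (1 - t) • γ.extensionAt hfill x β₂ := by
  obtain ⟨H₁, hH₁, e₁⟩ := hfill x β₁.1 β₁.2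
  obtain ⟨H₂, hH₂, e₂⟩ := hfill x β₂.1 β₂.2
  have e₃ : extD (t • H₁ + (1 - t) • H₂) x = β₃.1 := by
    rw [hH₁.extD_combination hH₂, e₁, e₂, h]
  ext w
  rw [LinearMap.add_apply, LinearMap.smul_apply, LinearMap.smul_apply,
    γ.extensionAt_apply hfill β₁ ⟨H₁, hH₁⟩ e₁, γ.extensionAt_apply hfill β₂ ⟨H₂, hH₂⟩ e₂,
    γ.extensionAt_apply hfill β₃ ⟨_, hH₁.combination hH₂ t⟩ e₃,
    γ.affine ⟨H₁, hH₁⟩ ⟨H₂, hH₂⟩ ⟨_, hH₁.combination hH₂ t⟩ t rfl x, LinearMap.add_apply,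
    LinearMap.smul_apply, LinearMap.smul_apply]
  module

/-- Because γ_H is a section of dτ, both v and any representative of γ_H(dτ v) have the same image
under dτ. -/
theorem SolutionMap.extensionAt_vertical (γ : SolutionMap D F τ) (x : M) (β : Γfib D F τ x) : IsVerticalValued D F τ (γ.extensionAt hfill x β) := by
  intro v w hw
  obtain ⟨H, hH, e⟩ := hfill x β.1 β.2
  rw [γ.extensionAt_apply hfill β ⟨H, hH⟩ e] at hw
  have h1 : (K₁ D x).mkQ (v - w) = (γ.toFun ⟨H, hH⟩).lift x (dmap E F τ x v) := by
    rw [map_sub, hw, sub_sub_cancel]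
  have h2 := (γ.toFun ⟨H, hH⟩).dmap_lift x _ _ h1
  rw [map_sub] at h2
  exact sub_eq_self.1 h2

/-- For a connection h over γ_H, h^*(dα) is computed twice: as dα - ι_L dα by the first-order
expansion, and from the Hamilton–De Donder–Weyl equations. Comparison on the spanning dα suffices.
-/
theorem SolutionMap.extensionAt_isExtensionValue [FiniteDimensional ℝ E] [SigmaCompactSpace M]
    [T2Space M] [FiniteDimensional ℝ F] [IsManifold 𝓘(ℝ, F) ∞ X] (hτ : IsFibered D F τ)
    (hspan : LocallySpannedByHamiltonianForms D) (γ : SolutionMap D F τ) (x : M)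
    (β : Γfib D F τ x) : IsExtensionValue D β.1 (γ.extensionAt hfill x β) := by
  obtain ⟨H, hH, e⟩ := hfill x β.1 β.2
  obtain ⟨h, hco⟩ := exists_horizontalLift_coincidesWith hτ (γ.toFun ⟨H, hH⟩)
  obtain ⟨U, hU, hxU, r, α, hα, hS⟩ := hspan x
  refine isExtensionValue_of_span β.2.1.1 (hS x hxU) ?_
  rintro ⟨_, hmem⟩ ⟨i, rfl⟩ v
  have h1 := congrArg (fun φ => φ v) (γ.solves ⟨H, hH⟩ h hco U hU (α i) (hα i) x hxU hmem)
  have h2 := hτ.apply_sub_vertical (γ.extensionAt_vertical hfill x β) hmem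
    (fun w => h.lift x (dmap E F τ x w)) (fun w => by
      rw [hco, γ.extensionAt_apply hfill β ⟨H, hH⟩ e, sub_sub_cancel]) v
  have h3 := h2.symm.trans h1
  rw [e] at h3
  exact sub_right_injective h3

theorem SolutionMap.extensionAt_smooth [FiniteDimensional ℝ E]
    (hΓ : IsAffineSubbundle (Γfib D F τ)) (γ : SolutionMap D F τ) (U : Set M) (hU : IsOpen U)
    (B : DForm E M (k + 1 + 1)) (hB : SmoothFormOn B U) (hBΓ : ∀ x ∈ U, B x ∈ Γfib D F τ x)
    (Y : ∀ x : M, Tan E x) (hY : SmoothFieldOn Y U) (s : ∀ x : M, Tan E x ⧸ K₁ D x)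
    (hs : ∀ x ∈ U, ∀ hB : B x ∈ Γfib D F τ x, s x = γ.extensionAt hfill x ⟨B x, hB⟩ (Y x)) :
    SmoothModOn (K₁ D) s U := by
  refine SmoothModOn.of_locally fun x₀ hx₀ => ?_
  obtain ⟨U', hU', hxU', r, f₀, f, hf₀, hf, hG⟩ := hΓ x₀
  obtain ⟨H₀, hH₀, e₀⟩ := hfill x₀ (f₀ x₀) (by
    rw [(hG x₀ hxU').2]
    simp)
  -- The differences dH j - dH₀ equal f j only at x₀. They remain in the direction space of Γ at
  -- nearby points, and independence at x₀ makes them a frame there.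
  choose H hH e using fun j => hfill x₀ (f₀ x₀ + f j x₀) (by
    rw [(hG x₀ hxU').2, mem_ofPred_eq, add_sub_cancel_left]
    exact Submodule.subset_span ⟨j, rfl⟩)
  have hmem : ∀ x ∈ U', ∀ β ∈ Γfib D F τ x,
      β - extD H₀ x ∈ Submodule.span ℝ (range fun j => f j x) := by
    intro x hx β hβ
    have h1 : ∀ β ∈ Γfib D F τ x, β - f₀ x ∈ Submodule.span ℝ (range fun j => f j x) :=
      fun β hβ => by
        rw [(hG x hx).2] at hβ
        exact hβ
    have h2 := Submodule.sub_mem _ (h1 β hβ) (h1 _ (hH₀.extD_mem_Γfib x))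
    rwa [sub_sub_sub_cancel_right] at h2
  have hsm : ∀ {H : DForm E M (k + 1)}, IsHamiltonian D F τ H → SmoothFormOn (extD H) (U ∩ U') :=
    fun h => (h.smooth.extD isOpen_univ).mono (subset_univ _)
  obtain ⟨V, c, hV, hxV, hVU, hc, hBc⟩ := exists_smooth_coefficients (hU.inter hU') ⟨hx₀, hxU'⟩
    ((hB.mono inter_subset_left).sub (hsm hH₀)) (b := fun j => extD (H j) - extD H₀)
    (fun j => (hsm (hH j)).sub (hsm hH₀))
    (by
      have : (fun j => (extD (H j) - extD H₀) x₀) = fun j => f j x₀ := by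
        funext j
        rw [Pi.sub_apply, e, e₀, add_sub_cancel_left]
      rw [this]
      exact (hG x₀ hxU').1)
    (W := fun x => Submodule.span ℝ (range fun j => f j x))
    (fun x hx => by rw [finrank_span_eq_card (hG x hx.2).1, Fintype.card_fin])
    (fun x hx j => hmem x hx.2 _ ((hH j).extD_mem_Γfib x))
    (fun x hx => hmem x hx.2 _ (hBΓ x hx.1))
  have hYV : SmoothFieldOn Y V := hY.mono fun x hx => (hVU hx).1
  have hval : ∀ (H : {H : DForm E M (k + 1) // IsHamiltonian D F τ H}), SmoothModOn (K₁ D)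
      (fun x => (K₁ D x).mkQ (Y x) - (γ.toFun H).lift x (dmap E F τ x (Y x))) V := fun H =>
    (hYV.smoothModOn hV).sub ((γ.toFun H).smooth V hV Y hYV)
  refine ⟨V, hV, hxV, _, (hval ⟨H₀, hH₀⟩).add (SmoothModOn.sum (I := Finset.univ) hV fun j _ =>
    ((hval ⟨H j, hH j⟩).sub (hval ⟨H₀, hH₀⟩)).smul (hc j) hV), fun x hx => ?_⟩
  -- Affinity expresses the value at B x through the values at the fixed Hamiltonians, each smooth
  -- in x, with the smooth coefficients c j.
  obtain ⟨h1, h2⟩ := exists_affine_sum (G := Γfib D F τ x)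
    (fun a ha b hb t => Γfib_combination ha hb t) (γ.extensionAt_affine hfill x)
    ⟨extD H₀ x, hH₀.extD_mem_Γfib x⟩ (fun j => ⟨extD (H j) x, (hH j).extD_mem_Γfib x⟩)
    (fun j => c j x) Finset.univ
  have h3 : B x = extD H₀ x + ∑ j, c j x • (extD (H j) x - extD H₀ x) :=
    sub_eq_iff_eq_add'.1 (hBc x hx)
  have hBx := hBΓ x (hVU hx).1
  have h4 : (⟨B x, hBx⟩ : Γfib D F τ x) = ⟨_, h1⟩ := Subtype.ext h3
  rw [hs x (hVU hx).1 hBx, h4, h2]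
  simp only [LinearMap.add_apply, LinearMap.sum_apply, LinearMap.smul_apply, LinearMap.sub_apply]
  rw [γ.extensionAt_apply hfill _ ⟨H₀, hH₀⟩ rfl]
  congr 1
  refine Finset.sum_congr rfl fun j _ => ?_
  rw [γ.extensionAt_apply hfill _ ⟨H j, hH j⟩ rfl]

end Correspondence

end GradedDirac

theorem mainTheorem3
    {E : Type*} [NormedAddCommGroup E] [NormedSpace ℝ E] [FiniteDimensional ℝ E]
    {M : Type*} [TopologicalSpace M] [T2Space M] [SecondCountableTopology M] [ChartedSpace E M]
    [IsManifold 𝓘(ℝ, E) ∞ M]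
    {F : Type*} [NormedAddCommGroup F] [NormedSpace ℝ F] [FiniteDimensional ℝ F]
    {X : Type*} [TopologicalSpace X] [T2Space X] [SecondCountableTopology X] [ChartedSpace F X]
    [IsManifold 𝓘(ℝ, F) ∞ X]
    {k : ℕ} (D : GradedDirac.AlmostGradedDirac E M k) (τ : M → X)
    (hτ : GradedDirac.IsFibered D F τ)
    (hspan : GradedDirac.LocallySpannedByHamiltonianForms D)
    (hΓ : GradedDirac.IsAffineSubbundle (GradedDirac.Γfib D F τ))
    (hfill : ∀ (x : M), ∀ β ∈ GradedDirac.Γfib D F τ x,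
      ∃ H : GradedDirac.DForm E M (k + 1), GradedDirac.IsHamiltonian D F τ H ∧
        GradedDirac.extD H x = β) :
    ∃ e : GradedDirac.VerticalExtension D F τ ≃ GradedDirac.SolutionMap D F τ,
      ∀ (σ : GradedDirac.VerticalExtension D F τ)
        (H : {H : GradedDirac.DForm E M (k + 1) // GradedDirac.IsHamiltonian D F τ H})
        (x : M) (w : GradedDirac.Tan E x),
        ((e σ).toFun H).lift x (GradedDirac.dmap E F τ x w) =
          (GradedDirac.K₁ D x).mkQ w - σ.toFun x ⟨GradedDirac.extD H.1 x, H.2.extD_mem_Γfib x⟩ w :=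
  by
  -- Together with second countability this yields σ-compactness, needed for partitions of unity.
  have : LocallyCompactSpace M := Manifold.locallyCompact_of_finiteDimensional 𝓘(ℝ, E)
  refine ⟨{
    toFun := fun σ => σ.toSolutionMap hτ
    invFun := fun γ =>
      { toFun := γ.extensionAt hfill
        affine := γ.extensionAt_affine hfill
        smooth := γ.extensionAt_smooth hfill hΓ
        isExtension := γ.extensionAt_isExtensionValue hfill hτ hspan
        vertical := γ.extensionAt_vertical hfill }
    left_inv := fun σ => GradedDirac.VerticalExtension.ext_toFun fun x β w => ?_
    right_inv := fun γ => GradedDirac.SolutionMap.ext_lift fun H x z => ?_ },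
    fun σ H x w => σ.liftAt_dmap hτ _ w⟩
  · obtain ⟨β, hβ⟩ := β
    obtain ⟨H, hH, rfl⟩ := hfill x β hβ
    refine (GradedDirac.SolutionMap.extensionAt_apply hfill _ _ ⟨H, hH⟩ rfl w).trans ?_
    refine (congrArg _ (σ.liftAt_dmap hτ _ w)).trans ?_
    rw [sub_sub_cancel]
  · obtain ⟨w, rfl⟩ := hτ.submersion x z
    refine (GradedDirac.VerticalExtension.liftAt_dmap hτ _ _ w).trans ?_
    rw [γ.extensionAt_apply hfill _ H rfl, sub_sub_cancel]
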